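/- Let $p$ be a prime, let $G$ be a profinite group having an open pro-$p$ subgroup, and let $H \le G$ be a closed subgroup of infinite index. All representations are over $\mathbb{C}$; a representation is smooth if the stabiliser of every vector is open. Let $(\theta, W)$ be a finite-dimensional smooth representation of $H$, and let $\rho = \mathrm{Ind}_H^G(\theta)$, i.e. $G$ acts by right translation on the space of locally constant functions $f\colon G \to W$ with $f(hx) = \theta(h) f(x)$ for all $h\in H$, $x \in G$. Let $\mathrm{Irr}(G)$ be the set of isomorphism classes of smooth irreducible representations of $G$ (all finite-dimensional), let $m(\pi,\rho)$ denote the multiplicity of $\pi\in \mathrm{Irr}(G)$ in $\rho$, and put $$r_n(\rho) = \sum_{\pi \in \mathrm{Irr}(G),\ \dim \pi = n} m(\pi,\rho), \qquad R_d(\rho) = \sum_{\pi \in \mathrm{Irr}(G),\ \dim \pi \le d} m(\pi,\rho).$$ Assume that $\rho$ is polynomially strongly admissible, i.e. that $\rho$ is smooth, that the space of $K$-fixed vectors of $\rho$ is finite-dimensional for every open subgroup $K \le G$, and that every $R_d(\rho)$ is finite with $R_d(\rho) \le C d^{r}$ for all $d \ge 1$ and some constants $r, C \in \mathbb{R}_{>0}$.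 Let $\zeta_\rho(s) = \sum_{n\ge 1} r_n(\rho)\, n^{-s}$. 1. The series $\sum_{n \ge 1} r_n(\rho)\, n$ converges (unconditionally) to $0$ in $\mathbb{Z}_p$. 2. Suppose that $\zeta_\rho$ is rational with respect to $p$, i.e. it has non-empty domain of convergence and admits a meromorphic continuation to $\mathbb{C}$ of the form $\sum_{i=1}^{k} m_i^{-s} F_i(p^{-s})$ (an identity of meromorphic functions) with finitely many positive integers $m_1, \dots, m_k$ and rational functions $F_1,\dots,F_k \in \mathbb{Q}(X)$. Then the meromorphic continuation of $\zeta_\rho$ is regular at $s=-1$ and $\zeta_\rho(-1) = 0$. -/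

import Mathlib

noncomputable section

namespace SmoothRep

universe u v

/-- A profinite group `P` is pro-`p` if every quotient by an open normal subgroup is a
(finite) `p`-group. -/
def IsProP (p : ℕ) (P : Type u) [Group P] [TopologicalSpace P] : Prop :=
  ∀ (N : Subgroup P) [N.Normal], IsOpen (N : Set P) → IsPGroup p (P ⧸ N)

/-- A profinite group is virtually pro-`p` if it has an open pro-`p` subgroup. -/
def IsVirtuallyProP (p : ℕ) (G : Type u) [Group G] [TopologicalSpace G] : Prop :=
  ∃ P : Subgroup G, IsOpen (P : Set G) ∧ IsProP p P

section Basic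

variable {G : Type u} [Group G] [TopologicalSpace G]
variable {V : Type v} [AddCommGroup V] [Module ℂ V]

/-- A complex representation is smooth if all stabilisers of vectors are open. -/
def IsSmooth (ρ : Representation ℂ G V) : Prop :=
  ∀ v : V, IsOpen {g : G | ρ g v = v}

/-- The space of vectors fixed by the subgroup `K`. -/
def fixedVectors (ρ : Representation ℂ G V) (K : Subgroup G) : Submodule ℂ V where
  carrier := {v | ∀ g ∈ K, ρ g v = v}
  add_mem' := by
    intro a b ha hb g hg
    rw [map_add, ha g hg, hb g hg]
  zero_mem' := by
    intro g _
    exact map_zero _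
  smul_mem' := by
    intro c a ha g hg
    rw [map_smul, ha g hg]

/-- A smooth representation of a profinite group is admissible if the fixed vectors of each open
(hence compact) subgroup form a finite-dimensional space. -/
def IsAdmissible (ρ : Representation ℂ G V) : Prop :=
  IsSmooth ρ ∧
    ∀ K : Subgroup G, IsOpen (K : Set G) → FiniteDimensional ℂ (fixedVectors ρ K)

end Basic

section Irr

/-- A finite-dimensional irreducible smooth representation, on a standard space `ℂⁿ`. -/
structure IrrRep (G : Type u) [Group G] [TopologicalSpace G] where
  /-- the dimension -/
  dim : ℕ
  /-- the representation -/
  rep : Representation ℂ G (Fin dim → ℂ)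
  smooth : IsSmooth rep
  irreducible : rep.IsIrreducible

variable (G : Type u) [Group G] [TopologicalSpace G]

/-- Isomorphism of representations. -/
instance irrSetoid : Setoid (IrrRep G) where
  r π σ := Nonempty (π.rep.Equiv σ.rep)
  iseqv :=
    { refl := fun π => ⟨Representation.Equiv.refl π.rep⟩
      symm := fun ⟨e⟩ => ⟨e.symm⟩
      trans := fun ⟨e⟩ ⟨f⟩ => ⟨e.trans f⟩ }

/-- `Irr G`: the isomorphism classes of irreducible smooth representations of the profinite
group `G`; they are all finite-dimensional. -/
def Irr : Type u := Quotient (irrSetoid G)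

variable {G}

/-- The dimension `dim π` of `π ∈ Irr G`. -/
def Irr.dim (π : Irr G) : ℕ :=
  Quotient.lift IrrRep.dim (by
    rintro π σ ⟨e⟩
    have h := LinearEquiv.finrank_eq e.toLinearEquiv
    simpa using h) π

variable {V : Type v} [AddCommGroup V] [Module ℂ V]

/-- The multiplicity `m(π, ρ) = dim Hom_G(π, ρ)` of `π ∈ Irr G` in the smooth (hence semisimple)
representation `ρ`. -/
def mult (π : Irr G) (ρ : Representation ℂ G V) : ℕ∞ :=
  Quotient.lift
    (fun π : IrrRep G => Cardinal.toENat (Module.rank ℂ (π.rep.IntertwiningMap ρ))) (by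
    rintro π σ ⟨e⟩
    refine congrArg Cardinal.toENat (LinearEquiv.rank_eq
      { toFun := fun f => f.comp e.symm.toIntertwiningMap
        invFun := fun f => f.comp e.toIntertwiningMap
        map_add' := fun f g => by ext x; rfl
        map_smul' := fun c f => by ext x; rfl
        left_inv := fun f => by
          apply DFunLike.ext
          intro x
          exact congrArg f (e.toLinearEquiv.symm_apply_apply x)
        right_inv := fun f => by
          apply DFunLike.ext
          intro x
          exact congrArg f (e.toLinearEquiv.apply_symm_apply x) })) π

/-- Sums in `ℕ∞` always exist: they are the suprema of the finite partial sums. -/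
theorem enat_tsum_eq_iSup {ι : Type*} (f : ι → ℕ∞) :
    ∑' i, f i = ⨆ s : Finset ι, ∑ i ∈ s, f i :=
  HasSum.tsum_eq (tendsto_atTop_iSup fun _ _ h => Finset.sum_le_sum_of_subset h)

/-- `r_n(ρ)`: the number of `n`-dimensional irreducible constituents of `ρ`, with
multiplicity. -/
def irrCount (ρ : Representation ℂ G V) (n : ℕ) : ℕ∞ :=
  ∑' π : {π : Irr G // π.dim = n}, mult π.1 ρ

/-- `R_d(ρ)`: the number of irreducible constituents of `ρ` of dimension at most `d`, with
multiplicity. -/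
def irrCountLE (ρ : Representation ℂ G V) (d : ℕ) : ℕ∞ :=
  ∑' π : {π : Irr G // π.dim ≤ d}, mult π.1 ρ

/-- `ρ` is strongly admissible: admissible smooth with all `R_d(ρ)` finite. -/
def IsStronglyAdmissible (ρ : Representation ℂ G V) : Prop :=
  IsAdmissible ρ ∧ ∀ d : ℕ, irrCountLE ρ d ≠ ⊤

/-- `ρ` is polynomially strongly admissible: admissible smooth, with all `R_d(ρ)` finite, and
`R_d(ρ) ≤ C d ^ r` for all `d ≥ 1` and suitable real `r, C > 0`. -/
def IsPolynomiallyStronglyAdmissible (ρ : Representation ℂ G V) : Prop :=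
  IsStronglyAdmissible ρ ∧ ∃ r C : ℝ, 0 < r ∧ 0 < C ∧
    ∀ d : ℕ, 1 ≤ d → ((irrCountLE ρ d).toNat : ℝ) ≤ C * (d : ℝ) ^ r

/-- The coefficients of the zeta function `ζ_ρ(s) = ∑ r_n(ρ) n^{-s}` of a strongly admissible
representation `ρ`; as a function on its half-plane of convergence, `ζ_ρ` is
`LSeries (zetaCoeff ρ)`. -/
def zetaCoeff (ρ : Representation ℂ G V) (n : ℕ) : ℂ :=
  ((irrCount ρ n).toNat : ℂ)

end Irr

section Induction

variable {G : Type u} [Group G] [TopologicalSpace G] [IsTopologicalGroup G]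
variable {W : Type v} [AddCommGroup W] [Module ℂ W]

/-- The space of the induced representation: locally constant functions `f : G → W` such that
`f (h x) = θ(h) (f x)` for `h ∈ H`, `x ∈ G`. -/
def indSpace (H : Subgroup G) (θ : Representation ℂ H W) : Submodule ℂ (G → W) where
  carrier := {f | IsLocallyConstant f ∧ ∀ (h : H) (x : G), f (h * x) = θ h (f x)}
  add_mem' := by
    rintro a b ⟨ha, ha'⟩ ⟨hb, hb'⟩
    refine ⟨ha.add hb, fun h x => ?_⟩
    simp [ha', hb']
  zero_mem' := ⟨IsLocallyConstant.const 0, fun h x => by simp⟩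
  smul_mem' := by
    rintro c a ⟨ha, ha'⟩
    refine ⟨ha.comp (fun w => c • w), fun h x => ?_⟩
    simp [ha']

/-- The induced representation `Ind_H^G(θ)`: `G` acts on `indSpace H θ` by right translation. -/
def ind (H : Subgroup G) (θ : Representation ℂ H W) : Representation ℂ G (indSpace H θ) where
  toFun g :=
    { toFun := fun f => ⟨fun x => f.1 (x * g),
        f.2.1.comp_continuous (continuous_mul_const g), fun h x => by
          change f.1 (h * x * g) = θ h (f.1 (x * g))
          rw [mul_assoc]
          exact f.2.2 h (x * g)⟩
      map_add' := fun _ _ => rfl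
      map_smul' := fun _ _ => rfl }
  map_one' := by
    ext f x
    simp
  map_mul' g k := by
    ext f x
    simp [mul_assoc]

end Induction

section Rationality

/-- `f` is the meromorphic continuation to `ℂ` of the Dirichlet series `∑ a_n n^{-s}`, normalised
so that `f` takes its analytic value wherever it is regular (and `0` at poles). -/
structure IsMeromorphicContinuation (a : ℕ → ℂ) (f : ℂ → ℂ) : Prop where
  meromorphic : MeromorphicNFOn f Set.univ
  eq_series : ∀ s : ℂ, LSeries.abscissaOfAbsConv a < (s.re : EReal) → f s = LSeries a s

/-- The Dirichlet series `∑ a_n n^{-s}` is rational with respect to `p`: its domain of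
convergence is non-empty and it has a meromorphic continuation of the form
`∑ᵢ mᵢ^{-s} Fᵢ(p^{-s})`, an identity of meromorphic functions, with finitely many positive
integers `mᵢ` and `Fᵢ ∈ ℚ(X)`. -/
def IsRationalWithRespectTo (p : ℕ) (a : ℕ → ℂ) : Prop :=
  LSeries.abscissaOfAbsConv a < ⊤ ∧
    ∃ f : ℂ → ℂ, IsMeromorphicContinuation a f ∧
      ∃ (r : ℕ) (m : Fin r → ℕ) (F : Fin r → RatFunc ℚ), (∀ i, 0 < m i) ∧
        f =ᶠ[Filter.codiscrete ℂ] fun s =>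
          ∑ i, (m i : ℂ) ^ (-s) * (F i).eval (algebraMap ℚ ℂ) ((p : ℂ) ^ (-s))

end Rationality

end SmoothRep

end

namespace SmoothRep

/-- The trace of an endomorphism of finite order is an algebraic integer. -/
theorem isIntegral_trace_of_pow_eq_one {V : Type*} [AddCommGroup V] [Module ℂ V]
    [FiniteDimensional ℂ V] (f : Module.End ℂ V) {n : ℕ} (hn : 0 < n) (hf : f ^ n = 1) :
    IsIntegral ℤ (LinearMap.trace ℂ V f) := by
  rw [Module.End.trace_eq_sum_roots_charpoly_of_splits (IsAlgClosed.splits _)]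
  refine IsIntegral.multiset_sum fun x hx => ?_
  have hx' : f.HasEigenvalue x := by
    rw [Module.End.hasEigenvalue_iff_isRoot_charpoly]
    exact Polynomial.isRoot_of_mem_roots hx
  obtain ⟨v, hv⟩ := hx'.exists_hasEigenvector
  have h1 := hv.pow_apply n
  rw [hf, Module.End.one_apply] at h1
  have h2 : x ^ n = 1 := by
    have : (x ^ n - 1) • v = 0 := by rw [sub_smul, ← h1, one_smul, sub_self]
    exact sub_eq_zero.mp ((smul_eq_zero.mp this).resolve_right hv.2)
  exact IsIntegral.of_pow hn (h2 ▸ isIntegral_one)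

theorem nontrivial_of_isIrreducible {G : Type*} [Group G] {V : Type*} [AddCommGroup V] [Module ℂ V]
    {ρ : Representation ℂ G V} (hρ : ρ.IsIrreducible) : Nontrivial V := by
  by_contra hV
  rw [not_nontrivial_iff_subsingleton] at hV
  obtain ⟨x, y, hxy⟩ := hρ.exists_pair_ne
  exact hxy (SetLike.ext fun v => by
    rw [Subsingleton.elim v 0]
    exact ⟨fun _ => y.toSubmodule.zero_mem, fun _ => x.toSubmodule.zero_mem⟩)

/-- The dimension of an irreducible complex representation of a finite group divides the order of
the group. -/
theorem finrank_dvd_card {Γ : Type*} [Group Γ] [Finite Γ] {V : Type*} [AddCommGroup V] [Module ℂ V]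
    [FiniteDimensional ℂ V] (σ : Representation ℂ Γ V) [σ.IsIrreducible] :
    Module.finrank ℂ V ∣ Nat.card Γ := by
  have := Fintype.ofFinite Γ
  have hcard : (Nat.card Γ : ℂ) ≠ 0 := Nat.cast_ne_zero.mpr Nat.card_pos.ne'
  have hint (g : Γ) : IsIntegral ℤ (σ.character g) :=
    isIntegral_trace_of_pow_eq_one _ Nat.card_pos (by rw [← map_pow, pow_card_eq_one', map_one])
  set A : Subalgebra ℤ ℂ := Algebra.adjoin ℤ (Set.range σ.character) with hA
  have hAfin : Module.Finite ℤ A := by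
    refine Algebra.finite_adjoin_of_finite_of_isIntegral (Set.finite_range _) ?_
    rintro _ ⟨g, rfl⟩
    exact hint g
  have : Module.Finite A (MonoidAlgebra A Γ) := inferInstance
  have : Module.Finite ℤ (MonoidAlgebra A Γ) := Module.Finite.trans A _
  let c (g : Γ) : A := ⟨σ.character g, Algebra.subset_adjoin ⟨g, rfl⟩⟩
  let z : MonoidAlgebra A Γ := ∑ g : Γ, MonoidAlgebra.single g (c g⁻¹)
  have hz : IsIntegral ℤ z := IsIntegral.of_finite ℤ z
  let φ : MonoidAlgebra A Γ →ₐ[A] Module.End ℂ V := MonoidAlgebra.lift A (Module.End ℂ V) Γ σ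
  have hφ : φ z = ∑ g : Γ, σ.character g⁻¹ • σ g := by
    simp only [φ, z, map_sum, MonoidAlgebra.lift_single]
    rfl
  have hφint : IsIntegral ℤ (φ z) := hz.map (φ.restrictScalars ℤ)
  let T : σ.IntertwiningMap σ := LinearMap.intertwiningMap_of_isIntertwiningMap σ σ (φ z) (by
    intro h v
    rw [hφ]
    simp only [LinearMap.sum_apply, LinearMap.smul_apply, map_sum, map_smul]
    refine Fintype.sum_bijective (fun g => h⁻¹ * g * h) ⟨fun a b hab => by simpa using hab,
      fun b => ⟨h * b * h⁻¹, by group⟩⟩ _ _ fun g => ?_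
    have h1 : σ.character (h⁻¹ * g * h)⁻¹ = σ.character g⁻¹ := by
      rw [show (h⁻¹ * g * h)⁻¹ = h⁻¹ * g⁻¹ * h⁻¹⁻¹ by group, Representation.char_conj]
    rw [h1, ← Module.End.mul_apply, ← Module.End.mul_apply, ← map_mul, ← map_mul]
    congr 3
    group)
  obtain ⟨a, ha⟩ :=
    (Representation.IsIrreducible.algebraMap_intertwiningMap_bijective_of_isAlgClosed (ρ := σ)).2 T
  have hscal : φ z = algebraMap ℂ (Module.End ℂ V) a := by
    ext v
    have := congrArg (fun S : σ.IntertwiningMap σ => S v) ha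
    exact this.symm
  have hV : Nontrivial V := nontrivial_of_isIrreducible (ρ := σ) inferInstance
  have hn : Module.finrank ℂ V ≠ 0 := Module.finrank_pos.ne'
  have haint : IsIntegral ℤ a := by
    rw [hscal] at hφint
    exact (isIntegral_algHom_iff ((Algebra.ofId ℂ (Module.End ℂ V)).restrictScalars ℤ)
      (FaithfulSMul.algebraMap_injective ℂ (Module.End ℂ V))).mp hφint
  have hinv : Invertible (Nat.card Γ : ℂ) := invertibleOfNonzero hcard
  have htr : a * Module.finrank ℂ V = Nat.card Γ := by
    have h1 := Representation.char_orthonormal σ σ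
    rw [if_pos ⟨Representation.Equiv.refl σ⟩, inv_mul_eq_one₀ hcard] at h1
    have h2 : LinearMap.trace ℂ V (φ z) = ∑ g, σ.character g * σ.character g⁻¹ := by
      rw [hφ, map_sum]
      refine Finset.sum_congr rfl fun g _ => ?_
      rw [map_smul, smul_eq_mul, mul_comm]
      rfl
    rw [← h1] at h2
    rw [← h2, hscal, Algebra.algebraMap_eq_smul_one, map_smul, LinearMap.trace_one, smul_eq_mul]
  have haq : a = algebraMap ℚ ℂ (Nat.card Γ / Module.finrank ℂ V) := by
    rw [map_div₀, map_natCast, map_natCast, ← htr]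
    field_simp
  rw [haq, isIntegral_algebraMap_iff (algebraMap ℚ ℂ).injective,
    IsIntegrallyClosed.isIntegral_iff] at haint
  obtain ⟨m, hm⟩ := haint
  have hm' : (m : ℚ) * Module.finrank ℂ V = Nat.card Γ := by
    rw [show (m : ℚ) = algebraMap ℤ ℚ m from rfl, hm]
    field_simp
  rw [← Int.natCast_dvd_natCast]
  exact ⟨m, by rw [mul_comm]; exact_mod_cast hm'.symm⟩

end SmoothRep

namespace SmoothRep

theorem pow_dvd_of_dvd_mul_pow {p M b k d : ℕ} (hp : p.Prime) (hM : 0 < M) (hd : d ∣ M * p ^ b)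
    (hle : M * p ^ k ≤ d) : p ^ k ∣ d := by
  obtain ⟨m, q, hm, hq, rfl⟩ := Nat.dvd_mul.mp hd
  obtain ⟨a, -, rfl⟩ := (Nat.dvd_prime_pow hp).mp hq
  have h1 : M * p ^ k ≤ M * p ^ a := hle.trans (Nat.mul_le_mul_right _ (Nat.le_of_dvd hM hm))
  have h2 : p ^ k ≤ p ^ a := Nat.le_of_mul_le_mul_left h1 hM
  exact (pow_dvd_pow p ((Nat.pow_le_pow_iff_right hp.one_lt).mp h2)).trans (dvd_mul_left _ _)

section Profinite

variable {G : Type*} [Group G] [TopologicalSpace G] [IsTopologicalGroup G] [CompactSpace G]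

theorem finiteIndex_of_isOpen {N : Subgroup G} (hN : IsOpen (N : Set G)) : N.FiniteIndex :=
  have : Finite (G ⧸ N) := N.quotient_finite_of_isOpen hN
  Subgroup.finiteIndex_of_finite_quotient

/-- The index of an open normal subgroup contained in a pro-`p` subgroup `P` is `[G : P]` times a
power of `p`. -/
theorem exists_index_eq_index_mul_pow {p : ℕ} [Fact p.Prime] {P : Subgroup G} (hP : IsProP p P)
    {N : Subgroup G} [N.Normal] (hN : IsOpen (N : Set G)) (hNP : N ≤ P) :
    ∃ b, N.index = P.index * p ^ b := by
  have hfin := finiteIndex_of_isOpen hN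
  have h1 : IsPGroup p (P ⧸ N.subgroupOf P) :=
    hP (N.subgroupOf P) (hN.preimage continuous_subtype_val)
  have : (N.subgroupOf P).FiniteIndex := inferInstance
  have : Finite (P ⧸ N.subgroupOf P) := Subgroup.finite_quotient_of_finiteIndex
  obtain ⟨b, hb⟩ := IsPGroup.iff_card.mp h1
  refine ⟨b, ?_⟩
  rw [← Subgroup.relIndex_mul_index hNP, mul_comm, ← hb]
  rfl

variable [TotallyDisconnectedSpace G]

theorem exists_normal_isOpen_subset {U : Set G} (hU : IsOpen U) (h1 : 1 ∈ U) :
    ∃ N : Subgroup G, N.Normal ∧ IsOpen (N : Set G) ∧ (N : Set G) ⊆ U := by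
  obtain ⟨N, hN⟩ := ProfiniteGrp.exist_openNormalSubgroup_sub_open_nhds_of_one hU h1
  exact ⟨N.toSubgroup, N.isNormal', N.isOpen', hN⟩

/-- A closed subgroup of infinite index is contained in open subgroups `H N`, with `N` normal, of
arbitrarily large index. -/
theorem exists_normal_isOpen_le_index_sup {H : Subgroup G} (hH : IsClosed (H : Set G))
    (hinf : ¬ H.FiniteIndex) (n : ℕ) :
    ∃ N : Subgroup G, N.Normal ∧ IsOpen (N : Set G) ∧ n ≤ (H ⊔ N).index := by
  induction n with
  | zero => exact ⟨⊤, inferInstance, isOpen_univ, Nat.zero_le _⟩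
  | succ n ih =>
    obtain ⟨N, hNn, hNo, hn⟩ := ih
    have hNfin := finiteIndex_of_isOpen hNo
    have hfin : (H ⊔ N).FiniteIndex := Subgroup.finiteIndex_of_le le_sup_right
    have hlt : H < H ⊔ N := lt_of_le_of_ne le_sup_left fun h => hinf (h ▸ hfin)
    obtain ⟨x, hx, hxH⟩ := SetLike.exists_of_lt hlt
    obtain ⟨N', hN'n, hN'o, hN'⟩ := exists_normal_isOpen_subset
      (U := (fun g => x * g) ⁻¹' (H : Set G)ᶜ) (hH.isOpen_compl.preimage (by fun_prop))
      (by simpa using hxH)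
    have hN''o : IsOpen ((N ⊓ N' : Subgroup G) : Set G) := hNo.inter hN'o
    refine ⟨N ⊓ N', inferInstance, hN''o, ?_⟩
    have hfin'' : (H ⊔ N ⊓ N').FiniteIndex :=
      have := finiteIndex_of_isOpen hN''o
      Subgroup.finiteIndex_of_le le_sup_right
    refine hn.trans_lt (Subgroup.index_strictAnti (lt_of_le_of_ne
      (sup_le_sup_left inf_le_left H) fun h => ?_))
    rw [← h] at hx
    obtain ⟨y, hy, z, hz, rfl⟩ := Subgroup.mem_sup_of_normal_right.mp hx
    exact hN' (N'.inv_mem hz.2) (by simpa using hy)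

end Profinite

/-- The kernel of a finite-dimensional smooth representation is open. -/
theorem IsSmooth.isOpen_ker {Γ : Type*} [Group Γ] [TopologicalSpace Γ] {W : Type*} [AddCommGroup W]
    [Module ℂ W] [FiniteDimensional ℂ W] {θ : Representation ℂ Γ W} (hθ : IsSmooth θ) :
    IsOpen {g : Γ | θ g = 1} := by
  have : {g : Γ | θ g = 1} = ⋂ i, {g | θ g (Module.finBasis ℂ W i) = Module.finBasis ℂ W i} := by
    ext g
    simp only [Set.mem_ofPred_eq, Set.mem_iInter]
    exact ⟨fun h i => by simp [h], fun h => (Module.finBasis ℂ W).ext fun i => by simp [h]⟩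
  rw [this]
  exact isOpen_iInter_of_finite fun i => hθ _

section Ind

open QuotientGroup

theorem exists_eq_mul_out_inv_mul {G : Type*} [Group G] (H N : Subgroup G) [N.Normal] (x : G) :
    ∃ h : H, ∃ n ∈ N, x = h * ((mk x⁻¹ : G ⧸ (H ⊔ N)).out)⁻¹ * n := by
  obtain ⟨y, hy⟩ := mk_out_eq_mul (H ⊔ N) x⁻¹
  obtain ⟨h, hh, n, hn, hhn⟩ := Subgroup.mem_sup_of_normal_right.mp y.2
  generalize (mk x⁻¹ : G ⧸ (H ⊔ N)).out = r at hy ⊢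
  refine ⟨⟨h, hh⟩, r * n * r⁻¹, (inferInstance : N.Normal).conj_mem n hn r, ?_⟩
  rw [hy, ← hhn]
  group

theorem mk_inv_mul_eq {G : Type*} [Group G] {H N : Subgroup G} [N.Normal] (h : H) {n : G}
    (hn : n ∈ N) (x : G) : (mk (h * x * n)⁻¹ : G ⧸ (H ⊔ N)) = mk x⁻¹ := by
  rw [eq_comm, QuotientGroup.eq]
  have h1 : x⁻¹⁻¹ * (h * x * n)⁻¹ = (x * n⁻¹ * x⁻¹) * (h : G)⁻¹ := by group
  rw [h1]
  exact mul_mem (le_sup_right (a := H) ((inferInstance : N.Normal).conj_mem _ (N.inv_mem hn) x))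
    (le_sup_left (b := N) (H.inv_mem h.2))

variable {G : Type*} [Group G] [TopologicalSpace G] [IsTopologicalGroup G]
variable {W : Type*} [AddCommGroup W] [Module ℂ W]

/-- The function on `G` determined by its values `φ` on representatives of `H \ G / N`. -/
noncomputable def indExtend (H N : Subgroup G) [N.Normal] (θ : Representation ℂ H W) (φ : G ⧸ (H ⊔ N) → W)
    (x : G) : W :=
  θ (exists_eq_mul_out_inv_mul H N x).choose (φ (mk x⁻¹))

variable {H N : Subgroup G} [N.Normal] {θ : Representation ℂ H W}

omit [TopologicalSpace G] [IsTopologicalGroup G] in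
theorem indExtend_apply (hNθ : ∀ h : H, (h : G) ∈ N → θ h = 1) (φ : G ⧸ (H ⊔ N) → W) {x : G} {h : H}
    {n : G} (hn : n ∈ N) (hx : x = h * ((mk x⁻¹ : G ⧸ (H ⊔ N)).out)⁻¹ * n) :
    indExtend H N θ φ x = θ h (φ (mk x⁻¹)) := by
  obtain ⟨n', hn', hx'⟩ := (exists_eq_mul_out_inv_mul H N x).choose_spec
  rw [indExtend]
  generalize (exists_eq_mul_out_inv_mul H N x).choose = h' at hx' ⊢
  generalize (mk x⁻¹ : G ⧸ (H ⊔ N)).out = r at hx hx'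
  have h1 : ((h'⁻¹ * h : H) : G) ∈ N := by
    have h2 : ((h'⁻¹ * h : H) : G) = r⁻¹ * (n' * n⁻¹) * r⁻¹⁻¹ := by
      have h3 : (h : G) * r⁻¹ * n = h' * r⁻¹ * n' := hx.symm.trans hx'
      have h4 : (h : G) = h' * r⁻¹ * n' * n⁻¹ * r := by rw [← h3]; group
      rw [Subgroup.coe_mul, Subgroup.coe_inv, h4]
      group
    rw [h2]
    exact (inferInstance : N.Normal).conj_mem _ (N.mul_mem hn' (N.inv_mem hn)) _
  have h5 : θ h = θ h' := by
    rw [show h = h' * (h'⁻¹ * h) by group, map_mul, hNθ _ h1, mul_one]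
  rw [h5]

omit [TopologicalSpace G] [IsTopologicalGroup G] in
theorem indExtend_mul (hNθ : ∀ h : H, (h : G) ∈ N → θ h = 1) (φ : G ⧸ (H ⊔ N) → W) (h : H)
    {n : G} (hn : n ∈ N) (x : G) :
    indExtend H N θ φ (h * x * n) = θ h (indExtend H N θ φ x) := by
  obtain ⟨h', n', hn', hx⟩ := exists_eq_mul_out_inv_mul H N x
  rw [indExtend_apply hNθ φ hn' hx, indExtend_apply (h := h * h') (n := n' * n) hNθ φ
    (N.mul_mem hn' hn), mk_inv_mul_eq h hn, map_mul, Module.End.mul_apply]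
  rw [mk_inv_mul_eq h hn]
  nth_rewrite 1 [hx]
  rw [Subgroup.coe_mul]
  group

/-- The space of `N`-fixed vectors of `Ind_H^G θ`, where `N` is an open normal subgroup with
`H ∩ N ≤ ker θ`, is the space of `W`-valued functions on `G / H N`. -/
theorem finrank_fixedVectors_ind [FiniteDimensional ℂ W] (hN : IsOpen (N : Set G))
    (hNθ : ∀ h : H, (h : G) ∈ N → θ h = 1) [(H ⊔ N).FiniteIndex] :
    Module.finrank ℂ (fixedVectors (ind H θ) N) = (H ⊔ N).index * Module.finrank ℂ W := by
  let T : fixedVectors (ind H θ) N →ₗ[ℂ] (G ⧸ (H ⊔ N) → W) :=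
    { toFun := fun f q => f.1.1 (q.out)⁻¹
      map_add' := fun _ _ => rfl
      map_smul' := fun _ _ => rfl }
  have hf (f : fixedVectors (ind H θ) N) (x : G) {n : G} (hn : n ∈ N) : f.1.1 (x * n) = f.1.1 x :=
    congrArg (fun k : indSpace H θ => k.1 x) (f.2 n hn)
  have hT : Function.Bijective T := by
    constructor
    · intro f f' hff'
      refine Subtype.ext (Subtype.ext (funext fun x => ?_))
      obtain ⟨h, n, hn, hx⟩ := exists_eq_mul_out_inv_mul H N x
      rw [hx, hf _ _ hn, hf _ _ hn, f.1.2.2, f'.1.2.2]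
      exact congrArg (θ h) (congrFun hff' (mk x⁻¹))
    · intro φ
      have hright (x : G) {n : G} (hn : n ∈ N) :
          indExtend H N θ φ (x * n) = indExtend H N θ φ x := by
        simpa using indExtend_mul hNθ φ 1 hn x
      refine ⟨⟨⟨indExtend H N θ φ, ?_, ?_⟩, ?_⟩, ?_⟩
      · rw [IsLocallyConstant.iff_exists_open]
        intro x
        refine ⟨(fun y => x⁻¹ * y) ⁻¹' (N : Set G), hN.preimage (by fun_prop), by simp, ?_⟩
        intro y hy
        simpa using hright x hy
      · intro h x
        simpa using indExtend_mul hNθ φ h N.one_mem x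
      · intro n hn
        exact Subtype.ext (funext fun x => hright x hn)
      · funext q
        change indExtend H N θ φ (q.out)⁻¹ = φ q
        have hq : (mk (q.out)⁻¹⁻¹ : G ⧸ (H ⊔ N)) = q := by rw [inv_inv]; exact Quotient.out_eq' q
        rw [indExtend_apply (h := 1) (n := 1) hNθ φ N.one_mem (by rw [hq]; simp), hq]
        simp
  have : Fintype (G ⧸ (H ⊔ N)) := Fintype.ofFinite _
  rw [(LinearEquiv.ofBijective T hT).finrank_eq, Module.finrank_pi_fintype, Finset.sum_const,
    Finset.card_univ, smul_eq_mul, Subgroup.index, Nat.card_eq_fintype_card]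

end Ind

end SmoothRep

namespace SmoothRep

open Representation

universe u v w

section Irreducible

variable {G : Type u} [Group G] {V : Type v} [AddCommGroup V] [Module ℂ V]
  {W : Type w} [AddCommGroup W] [Module ℂ W]

theorem isIrreducible_of_forall [Nontrivial V] {ρ : Representation ℂ G V}
    (h : ∀ U : Subrepresentation ρ, U.toSubmodule = ⊥ ∨ U.toSubmodule = ⊤) : ρ.IsIrreducible where
  exists_pair_ne := ⟨⊥, ⊤, fun h => bot_ne_top (congrArg Subrepresentation.toSubmodule h)⟩
  eq_bot_or_eq_top U := (h U).imp (fun h => Subrepresentation.toSubmodule_injective h)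
    fun h => Subrepresentation.toSubmodule_injective h

theorem eq_bot_or_eq_top_of_isIrreducible {ρ : Representation ℂ G V} (hρ : ρ.IsIrreducible)
    (U : Subrepresentation ρ) : U.toSubmodule = ⊥ ∨ U.toSubmodule = ⊤ :=
  (hρ.eq_bot_or_eq_top U).imp (congrArg Subrepresentation.toSubmodule)
    (congrArg Subrepresentation.toSubmodule)

theorem IsIrreducible.of_equiv {ρ : Representation ℂ G V} {σ : Representation ℂ G W}
    (hρ : ρ.IsIrreducible) (e : ρ.Equiv σ) : σ.IsIrreducible := by
  have := nontrivial_of_isIrreducible hρ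
  have : Nontrivial W := e.toLinearEquiv.symm.toEquiv.nontrivial
  refine isIrreducible_of_forall fun U => ?_
  let U' : Subrepresentation ρ :=
    { toSubmodule := U.toSubmodule.comap e.toLinearEquiv.toLinearMap
      apply_mem_toSubmodule := fun g v hv => by
        have h1 : e.toLinearEquiv (ρ g v) = σ g (e.toLinearEquiv v) :=
          e.toIntertwiningMap.isIntertwining ρ σ g v
        rw [Submodule.mem_comap] at hv ⊢
        change e.toLinearEquiv (ρ g v) ∈ _
        rw [h1]
        exact U.apply_mem_toSubmodule g hv }
  have hU : U.toSubmodule = U'.toSubmodule.map e.toLinearEquiv.toLinearMap :=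
    (Submodule.map_comap_eq_of_surjective e.toLinearEquiv.surjective _).symm
  rcases eq_bot_or_eq_top_of_isIrreducible hρ U' with h | h
  · left
    rw [hU, h, Submodule.map_bot]
  · right
    rw [hU, h, Submodule.map_top, LinearEquiv.range]

/-- Transport of a representation along a linear equivalence. -/
def transport (ρ : Representation ℂ G V) (e : V ≃ₗ[ℂ] W) : Representation ℂ G W where
  toFun g := e.toLinearMap ∘ₗ ρ g ∘ₗ e.symm.toLinearMap
  map_one' := by ext; simp
  map_mul' g h := by ext; simp

/-- A representation is equivalent to its transport. -/
def equivTransport (ρ : Representation ℂ G V) (e : V ≃ₗ[ℂ] W) : ρ.Equiv (transport ρ e) :=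
  Representation.Equiv.mk e fun g => by ext; simp [transport]

/-- A nonzero finite-dimensional representation has an irreducible subrepresentation. -/
theorem exists_irreducible_subrepresentation [FiniteDimensional ℂ V] [Nontrivial V]
    (ρ : Representation ℂ G V) :
    ∃ S : Subrepresentation ρ, S.toRepresentation.IsIrreducible := by
  let p (d : ℕ) : Prop := ∃ S : Subrepresentation ρ, S.toSubmodule ≠ ⊥ ∧
    Module.finrank ℂ S.toSubmodule = d
  have hp : ∃ d, p d := ⟨_, ⊤, top_ne_bot, rfl⟩
  classical
  obtain ⟨S, hS, hd⟩ := Nat.find_spec hp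
  have : Nontrivial S.toSubmodule := Submodule.nontrivial_iff_ne_bot.mpr hS
  refine ⟨S, isIrreducible_of_forall fun U => or_iff_not_imp_left.mpr fun hU => ?_⟩
  let U' : Subrepresentation ρ :=
    { toSubmodule := U.toSubmodule.map S.toSubmodule.subtype
      apply_mem_toSubmodule := by
        rintro g _ ⟨v, hv, rfl⟩
        exact ⟨S.toRepresentation g v, U.apply_mem_toSubmodule g hv, rfl⟩ }
  have h1 : Nat.find hp ≤ Module.finrank ℂ U'.toSubmodule := by
    refine Nat.find_min' hp ⟨U', fun h => hU ?_, rfl⟩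
    exact Submodule.map_injective_of_injective S.toSubmodule.subtype_injective (by rw [Submodule.map_bot]; exact h)
  have h2 : Module.finrank ℂ U'.toSubmodule = Module.finrank ℂ U.toSubmodule :=
    (Submodule.equivMapOfInjective _ S.toSubmodule.subtype_injective _).finrank_eq.symm
  exact Submodule.eq_top_of_finrank_eq
    (le_antisymm (Submodule.finrank_le _) (by rw [hd, ← h2]; exact h1))

/-- Maschke's theorem for representations that factor through a finite quotient. -/
theorem exists_isCompl_subrepresentation {N : Subgroup G} [N.Normal] [N.FiniteIndex]
    {ρ : Representation ℂ G V} (hρ : ∀ n ∈ N, ρ n = 1) (S : Subrepresentation ρ) :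
    ∃ S' : Subrepresentation ρ, IsCompl S.toSubmodule S'.toSubmodule := by
  have : IsTrivial (MonoidHom.comp ρ N.subtype) := ⟨fun n => hρ n n.2⟩
  have : Finite (G ⧸ N) := Subgroup.finite_quotient_of_finiteIndex
  have : NeZero (Nat.card (G ⧸ N) : ℂ) := ⟨Nat.cast_ne_zero.mpr Nat.card_pos.ne'⟩
  let T : Subrepresentation (ofQuotient ρ N) :=
    { toSubmodule := S.toSubmodule
      apply_mem_toSubmodule := fun q => QuotientGroup.induction_on q fun g _ hv =>
        S.apply_mem_toSubmodule g hv }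
  obtain ⟨T', hT'⟩ := exists_isCompl T
  refine ⟨⟨T'.toSubmodule, fun g v hv => T'.apply_mem_toSubmodule (g : G ⧸ N) hv⟩, ?_⟩
  exact ⟨disjoint_iff.mpr (congrArg Subrepresentation.toSubmodule hT'.1.eq_bot),
    codisjoint_iff.mpr (congrArg Subrepresentation.toSubmodule hT'.2.eq_top)⟩

/-- A representation is the product of complementary subrepresentations. -/
noncomputable def prodEquivOfIsCompl {ρ : Representation ℂ G V} {S S' : Subrepresentation ρ}
    (h : IsCompl S.toSubmodule S'.toSubmodule) :
    (S.toRepresentation.prod S'.toRepresentation).Equiv ρ :=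
  Representation.Equiv.mk (Submodule.prodEquivOfIsCompl _ _ h) fun g => by
    refine LinearMap.ext fun x => ?_
    exact (map_add (ρ g) x.1.1 x.2.1).symm

end Irreducible

section Mult

variable {G : Type u} [Group G] [TopologicalSpace G] {V : Type v} [AddCommGroup V] [Module ℂ V]
  {W : Type v} [AddCommGroup W] [Module ℂ W]

/-- The isomorphism class of an irreducible representation. -/
def Irr.mk (π : IrrRep G) : Irr G := Quotient.mk _ π

theorem Irr.exists_eq_mk (π : Irr G) : ∃ π₀, π = Irr.mk π₀ :=
  (Quotient.exists_rep π).imp fun _ h => h.symm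

theorem Irr.mk_eq_mk {π σ : IrrRep G} : Irr.mk π = Irr.mk σ ↔ Nonempty (π.rep.Equiv σ.rep) :=
  Quotient.eq

theorem Irr.dim_mk (π : IrrRep G) : (Irr.mk π).dim = π.dim := rfl

theorem mult_mk (π : IrrRep G) (ρ : Representation ℂ G V) :
    mult (Irr.mk π) ρ = Cardinal.toENat (Module.rank ℂ (π.rep.IntertwiningMap ρ)) := rfl

/-- Postcomposition with an equivalence of representations. -/
def intertwiningMapCongrRight {G : Type u} [Group G] {U : Type*} [AddCommGroup U] [Module ℂ U]
    {V : Type*} [AddCommGroup V] [Module ℂ V] {W : Type*} [AddCommGroup W] [Module ℂ W]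
    (π : Representation ℂ G U) {ρ : Representation ℂ G V} {σ : Representation ℂ G W}
    (e : ρ.Equiv σ) : π.IntertwiningMap ρ ≃ₗ[ℂ] π.IntertwiningMap σ where
  toFun f := e.toIntertwiningMap.comp f
  invFun f := e.symm.toIntertwiningMap.comp f
  map_add' f g := by ext x; simp
  map_smul' c f := by ext x; simp
  left_inv f := DFunLike.ext _ _ fun x => e.toLinearEquiv.symm_apply_apply (f x)
  right_inv f := DFunLike.ext _ _ fun x => e.toLinearEquiv.apply_symm_apply (f x)

theorem mult_congr (π : Irr G) {ρ : Representation ℂ G V} {σ : Representation ℂ G W}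
    (e : ρ.Equiv σ) : mult π ρ = mult π σ := by
  obtain ⟨π, rfl⟩ := π.exists_eq_mk
  exact congrArg Cardinal.toENat (intertwiningMapCongrRight π.rep e).rank_eq

theorem mult_prod (π : Irr G) (ρ : Representation ℂ G V) (σ : Representation ℂ G W) :
    mult π (ρ.prod σ) = mult π ρ + mult π σ := by
  obtain ⟨π, rfl⟩ := π.exists_eq_mk
  rw [mult_mk, mult_mk, mult_mk, ← map_add, ← rank_prod']
  exact congrArg Cardinal.toENat (LinearEquiv.rank_eq
    { toFun := fun f => ((IntertwiningMap.fst ℂ ρ σ).comp f, (IntertwiningMap.snd ℂ ρ σ).comp f)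
      invFun := fun f => f.1.prod f.2
      map_add' := fun f g => rfl
      map_smul' := fun c f => rfl
      left_inv := fun f => rfl
      right_inv := fun f => rfl })

open Classical in
theorem mult_of_equiv (π : Irr G) {π₀ : IrrRep G} {ρ : Representation ℂ G V}
    (e : π₀.rep.Equiv ρ) : mult π ρ = if π = Irr.mk π₀ then 1 else 0 := by
  obtain ⟨π, rfl⟩ := π.exists_eq_mk
  have := π.irreducible
  have hρ := IsIrreducible.of_equiv π₀.irreducible e
  rw [mult_mk]
  split_ifs with h
  · obtain ⟨e'⟩ := Irr.mk_eq_mk.mp h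
    have h1 := (intertwiningMapCongrRight π.rep (e'.trans e)).finrank_eq
    rw [IsIrreducible.finrank_intertwiningMap_self π.rep] at h1
    rw [(Module.rank_eq_one_iff_finrank_eq_one).mpr h1.symm, map_one]
  · have : IsEmpty (π.rep.Equiv ρ) := ⟨fun e' => h (Irr.mk_eq_mk.mpr ⟨e'.trans e.symm⟩)⟩
    rw [rank_subsingleton', map_zero]

variable [IsTopologicalGroup G]

theorem isSmooth_of_forall_mem {N : Subgroup G} (hN : IsOpen (N : Set G))
    {ρ : Representation ℂ G V} (hρ : ∀ n ∈ N, ρ n = 1) : IsSmooth ρ := by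
  intro v
  rw [isOpen_iff_forall_mem_open]
  intro g hg
  refine ⟨(fun x => g⁻¹ * x) ⁻¹' (N : Set G), fun x hx => ?_, hN.preimage (by fun_prop), by simp⟩
  have h1 : ρ x = ρ g := by
    rw [← mul_inv_cancel_left g x, map_mul, hρ _ hx, mul_one]
  rw [Set.mem_ofPred_eq, h1]
  exact hg

/-- Every finite-dimensional irreducible smooth representation is isomorphic to one on a standard
space. -/
theorem exists_irrRep_equiv [FiniteDimensional ℂ V] {N : Subgroup G} (hN : IsOpen (N : Set G))
    {ρ : Representation ℂ G V} (hρ : ∀ n ∈ N, ρ n = 1) (hirr : ρ.IsIrreducible) :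
    ∃ π : IrrRep G, π.dim = Module.finrank ℂ V ∧ Nonempty (π.rep.Equiv ρ) := by
  let e := (Module.finBasis ℂ V).equivFun
  refine ⟨⟨_, transport ρ e, isSmooth_of_forall_mem hN fun n hn => ?_,
    IsIrreducible.of_equiv hirr (equivTransport ρ e)⟩, rfl, ⟨(equivTransport ρ e).symm⟩⟩
  ext
  simp [transport, hρ n hn]

open Classical in
/-- A finite-dimensional representation that factors through a finite quotient by an open subgroup
is a direct sum of irreducible representations. -/
theorem exists_multiset_irr {N : Subgroup G} [N.Normal] [N.FiniteIndex] (hN : IsOpen (N : Set G))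
    (V : Type v) [AddCommGroup V] [Module ℂ V] [FiniteDimensional ℂ V] (ρ : Representation ℂ G V)
    (hρ : ∀ n ∈ N, ρ n = 1) :
    ∃ M : Multiset (Irr G), (∀ π, mult π ρ = M.count π) ∧
      Module.finrank ℂ V = (M.map Irr.dim).sum := by
  induction hd : Module.finrank ℂ V using Nat.strong_induction_on generalizing V with
  | _ d ih =>
    subst hd
    rcases subsingleton_or_nontrivial V with hV | hV
    · refine ⟨0, fun π => ?_, by simp [Module.finrank_zero_of_subsingleton]⟩
      obtain ⟨π, rfl⟩ := π.exists_eq_mk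
      have : Subsingleton (π.rep.IntertwiningMap ρ) :=
        ⟨fun f g => DFunLike.ext _ _ fun x => Subsingleton.elim _ _⟩
      rw [mult_mk, rank_subsingleton', map_zero, Multiset.count_zero, Nat.cast_zero]
    · obtain ⟨S, hS⟩ := exists_irreducible_subrepresentation ρ
      obtain ⟨S', hSS'⟩ := exists_isCompl_subrepresentation hρ S
      have hsub (T : Subrepresentation ρ) (n : G) (hn : n ∈ N) : T.toRepresentation n = 1 := by
        ext v
        exact congrArg (fun f : Module.End ℂ V => f v) (hρ n hn)
      obtain ⟨π₀, hdim, ⟨e⟩⟩ := exists_irrRep_equiv hN (hsub S) hS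
      have hfin := Submodule.finrank_add_eq_of_isCompl hSS'
      have := nontrivial_of_isIrreducible hS
      have hpos : 0 < Module.finrank ℂ S.toSubmodule := Module.finrank_pos
      obtain ⟨M, hM, hMd⟩ := ih _ (by omega) S'.toSubmodule S'.toRepresentation (hsub S') rfl
      refine ⟨Irr.mk π₀ ::ₘ M, fun π => ?_, ?_⟩
      · rw [← mult_congr π (prodEquivOfIsCompl hSS'), mult_prod, hM, mult_of_equiv π e,
          Multiset.count_cons, add_comm]
        push_cast
        rfl
      · rw [Multiset.map_cons, Multiset.sum_cons, ← hMd, Irr.dim_mk, hdim, hfin]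

/-- The subrepresentation of vectors fixed by a normal subgroup. -/
def fixedSubrepresentation {G : Type*} [Group G] {V : Type*} [AddCommGroup V] [Module ℂ V]
    (ρ : Representation ℂ G V) (N : Subgroup G) [N.Normal] : Subrepresentation ρ where
  toSubmodule := fixedVectors ρ N
  apply_mem_toSubmodule g v hv n hn := by
    have h1 := hv _ ((inferInstance : N.Normal).conj_mem n hn g⁻¹)
    rw [← Module.End.mul_apply, ← map_mul, show n * g = g * (g⁻¹ * n * g⁻¹⁻¹) by group, map_mul,
      Module.End.mul_apply, h1]

/-- The normal subgroup `N` acts trivially on `π`. -/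
def Irr.IsTrivialOn (π : Irr G) (N : Subgroup G) : Prop :=
  ∃ π₀, π = Irr.mk π₀ ∧ ∀ n ∈ N, π₀.rep n = 1

omit [IsTopologicalGroup G] in
theorem Irr.IsTrivialOn.mono {π : Irr G} {N N' : Subgroup G} (h : π.IsTrivialOn N) (hN : N' ≤ N) :
    π.IsTrivialOn N' :=
  h.imp fun _ h => ⟨h.1, fun n hn => h.2 n (hN hn)⟩

omit [IsTopologicalGroup G] in
theorem Irr.isTrivialOn_of_mult_ne_zero {π : Irr G} {ρ : Representation ℂ G V} {N : Subgroup G}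
    (hρ : ∀ n ∈ N, ρ n = 1) (h : mult π ρ ≠ 0) : π.IsTrivialOn N := by
  obtain ⟨π, rfl⟩ := π.exists_eq_mk
  refine ⟨π, rfl, fun n hn => ?_⟩
  have := π.irreducible
  obtain ⟨f, hf⟩ : ∃ f : π.rep.IntertwiningMap ρ, f ≠ 0 := by
    by_contra! hf
    have : Subsingleton (π.rep.IntertwiningMap ρ) := ⟨fun f g => by rw [hf f, hf g]⟩
    exact h (by rw [mult_mk, rank_subsingleton', map_zero])
  have hinj := (IsIrreducible.injective_or_eq_zero f).resolve_right hf
  refine LinearMap.ext fun v => hinj ?_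
  rw [f.isIntertwining, hρ n hn]
  rfl

omit [IsTopologicalGroup G] in
theorem mult_fixedSubrepresentation {π : Irr G} {N : Subgroup G} [N.Normal]
    (hπ : π.IsTrivialOn N) (ρ : Representation ℂ G V) :
    mult π (fixedSubrepresentation ρ N).toRepresentation = mult π ρ := by
  obtain ⟨π, rfl, hπ⟩ := hπ
  refine congrArg Cardinal.toENat (LinearEquiv.rank_eq
    { toFun := fun f => LinearMap.intertwiningMap_of_isIntertwiningMap π.rep ρ
        ((fixedVectors ρ N).subtype ∘ₗ f.toLinearMap) fun g v =>
          congrArg Subtype.val (f.isIntertwining _ _ g v)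
      invFun := fun f => LinearMap.intertwiningMap_of_isIntertwiningMap π.rep
        (fixedSubrepresentation ρ N).toRepresentation
        (f.toLinearMap.codRestrict (fixedVectors ρ N) fun v n hn => by
          have h1 := f.isIntertwining _ _ n v
          rw [hπ n hn] at h1
          exact h1.symm) fun g v => Subtype.ext (f.isIntertwining _ _ g v)
      map_add' := fun f g => rfl
      map_smul' := fun c f => rfl
      left_inv := fun f => rfl
      right_inv := fun f => rfl })

open Classical in
/-- The decomposition of the `N`-fixed vectors of an admissible representation. -/
theorem exists_multiset_irr_fixedVectors {N : Subgroup G} [N.Normal] [N.FiniteIndex]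
    (hN : IsOpen (N : Set G)) (ρ : Representation ℂ G V) [FiniteDimensional ℂ (fixedVectors ρ N)] :
    ∃ M : Multiset (Irr G), (∀ π ∈ M, π.IsTrivialOn N) ∧
      (∀ π : Irr G, π.IsTrivialOn N → mult π ρ = M.count π) ∧
      Module.finrank ℂ (fixedVectors ρ N) = (M.map Irr.dim).sum := by
  have htriv : ∀ n ∈ N, (fixedSubrepresentation ρ N).toRepresentation n = 1 := by
    intro n hn
    ext v
    exact v.2 n hn
  have hfin : FiniteDimensional ℂ (fixedSubrepresentation ρ N).toSubmodule :=
    inferInstanceAs (FiniteDimensional ℂ (fixedVectors ρ N))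
  obtain ⟨M, hM, hMd⟩ := exists_multiset_irr hN
    (fixedSubrepresentation ρ N).toSubmodule (fixedSubrepresentation ρ N).toRepresentation htriv
  refine ⟨M, fun π hπ => Irr.isTrivialOn_of_mult_ne_zero htriv ?_, fun π hπ => ?_, hMd⟩
  · rw [hM]
    exact_mod_cast (Multiset.count_pos.mpr hπ).ne'
  · rw [← hM, mult_fixedSubrepresentation hπ]

omit [IsTopologicalGroup G] in
/-- If `N` acts trivially on `π`, then `dim π` divides `[G : N]`. -/
theorem Irr.IsTrivialOn.dim_dvd_index {π : Irr G} {N : Subgroup G} [N.Normal] [N.FiniteIndex]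
    (hπ : π.IsTrivialOn N) : π.dim ∣ N.index := by
  obtain ⟨π, rfl, hπ⟩ := hπ
  have : IsTrivial (MonoidHom.comp π.rep N.subtype) := ⟨fun n => hπ n n.2⟩
  have : Finite (G ⧸ N) := Subgroup.finite_quotient_of_finiteIndex
  have := nontrivial_of_isIrreducible π.irreducible
  have : (ofQuotient π.rep N).IsIrreducible := isIrreducible_of_forall fun U =>
    eq_bot_or_eq_top_of_isIrreducible π.irreducible
      ⟨U.toSubmodule, fun g v hv => U.apply_mem_toSubmodule (g : G ⧸ N) hv⟩
  have h1 := finrank_dvd_card (ofQuotient π.rep N)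
  rwa [Module.finrank_fin_fun] at h1

end Mult

end SmoothRep

namespace SmoothRep

open Filter Topology

universe u v

section ENatSum

theorem le_enat_tsum {ι : Type*} (f : ι → ℕ∞) (s : Finset ι) : ∑ i ∈ s, f i ≤ ∑' i, f i := by
  rw [enat_tsum_eq_iSup]
  exact le_iSup (fun s : Finset ι => ∑ i ∈ s, f i) s

theorem finite_support_of_enat_tsum_ne_top {ι : Type*} {f : ι → ℕ∞} (h : ∑' i, f i ≠ ⊤) :
    f.support.Finite := by
  by_contra hinf
  refine h (ENat.eq_top_iff_forall_ge.mpr fun n => ?_)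
  obtain ⟨s, hs, hcard⟩ := Set.Infinite.exists_subset_card_eq hinf n
  calc (n : ℕ∞) = ∑ _i ∈ s, 1 := by simp [hcard]
    _ ≤ ∑ i ∈ s, f i := Finset.sum_le_sum fun i hi => Order.one_le_iff_ne_zero.mpr (hs hi)
    _ ≤ _ := le_enat_tsum f s

end ENatSum

section StronglyAdmissible

variable {G : Type u} [Group G] [TopologicalSpace G] {V : Type v} [AddCommGroup V] [Module ℂ V]
  {ρ : Representation ℂ G V}

theorem IsStronglyAdmissible.finite_setOf_dim_le (hρ : IsStronglyAdmissible ρ) (d : ℕ) :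
    {π : Irr G | π.dim ≤ d ∧ mult π ρ ≠ 0}.Finite := by
  refine ((finite_support_of_enat_tsum_ne_top (hρ.2 d)).image Subtype.val).subset ?_
  exact fun π hπ => ⟨⟨π, hπ.1⟩, hπ.2, rfl⟩

theorem IsStronglyAdmissible.mult_ne_top (hρ : IsStronglyAdmissible ρ) (π : Irr G) :
    mult π ρ ≠ ⊤ := by
  refine ne_top_of_le_ne_top (hρ.2 π.dim) ?_
  have h := le_enat_tsum (fun σ : {σ : Irr G // σ.dim ≤ π.dim} => mult σ.1 ρ) {⟨π, le_rfl⟩}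
  rwa [Finset.sum_singleton] at h

/-- Summing first over the irreducible representations of a given dimension. -/
theorem IsStronglyAdmissible.hasSum_irrCount {R : Type*} [CommSemiring R] [TopologicalSpace R]
    [RegularSpace R] [ContinuousAdd R]
    (hρ : IsStronglyAdmissible ρ) {S : R}
    (h : HasSum (fun π : Irr G => ((mult π ρ).toNat : R) * π.dim) S) :
    HasSum (fun n : ℕ => ((irrCount ρ n).toNat : R) * n) S := by
  have h1 := (Equiv.sigmaFiberEquiv (Irr.dim (G := G))).hasSum_iff.mpr h
  refine h1.sigma fun n => ?_
  have hfin : (fun π : {π : Irr G // π.dim = n} => mult π.1 ρ).support.Finite :=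
    Set.Finite.of_finite_image ((hρ.finite_setOf_dim_le n).subset (by
      rintro _ ⟨π, hπ, rfl⟩
      exact ⟨π.2.le, hπ⟩)) Subtype.val_injective.injOn
  have h2 : irrCount ρ n = ∑ π ∈ hfin.toFinset, mult π.1 ρ :=
    tsum_eq_sum fun π hπ => by simpa using hπ
  have h3 : ((irrCount ρ n).toNat : R) * n =
      ∑ π ∈ hfin.toFinset, ((mult π.1 ρ).toNat : R) * π.1.dim := by
    have h4 : irrCount ρ n = ((∑ π ∈ hfin.toFinset, (mult π.1 ρ).toNat : ℕ) : ℕ∞) := by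
      rw [h2, Nat.cast_sum]
      exact Finset.sum_congr rfl fun π _ => (ENat.natCast_toNat (hρ.mult_ne_top _)).symm
    rw [h4, ENat.toNat_natCast, Nat.cast_sum, Finset.sum_mul]
    exact Finset.sum_congr rfl fun π _ => by rw [π.2]
  rw [h3]
  refine hasSum_sum_of_ne_finset_zero fun π hπ => ?_
  have h5 : mult π.1 ρ = 0 := by simpa using hπ
  simp [Equiv.sigmaFiberEquiv, h5]

end StronglyAdmissible

section Profinite

variable {G : Type u} [Group G] [TopologicalSpace G] [IsTopologicalGroup G] [CompactSpace G]
  [TotallyDisconnectedSpace G]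

theorem Irr.exists_isTrivialOn (π : Irr G) :
    ∃ N : Subgroup G, N.Normal ∧ IsOpen (N : Set G) ∧ π.IsTrivialOn N := by
  obtain ⟨π, rfl⟩ := π.exists_eq_mk
  obtain ⟨N, hN, hNo, hNπ⟩ := exists_normal_isOpen_subset π.smooth.isOpen_ker (map_one π.rep)
  exact ⟨N, hN, hNo, π, rfl, fun n hn => hNπ hn⟩

theorem exists_forall_isTrivialOn (s : Finset (Irr G)) {U : Set G} (hU : IsOpen U)
    (h1 : 1 ∈ U) : ∃ N : Subgroup G, N.Normal ∧ IsOpen (N : Set G) ∧ (N : Set G) ⊆ U ∧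
      ∀ π ∈ s, π.IsTrivialOn N := by
  classical
  induction s using Finset.induction_on with
  | empty =>
    obtain ⟨N, hN, hNo, hNU⟩ := exists_normal_isOpen_subset hU h1
    exact ⟨N, hN, hNo, hNU, by simp⟩
  | insert π s _ ih =>
    obtain ⟨N, hN, hNo, hNU, hNs⟩ := ih
    obtain ⟨N', hN', hNo', hNπ⟩ := π.exists_isTrivialOn
    refine ⟨N ⊓ N', inferInstance, hNo.inter hNo', fun x hx => hNU hx.1, fun σ hσ => ?_⟩
    rcases Finset.mem_insert.mp hσ with rfl | hσ
    · exact hNπ.mono inf_le_right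
    · exact (hNs σ hσ).mono inf_le_left

variable {p : ℕ} [hp : Fact p.Prime] {P : Subgroup G}

theorem Irr.pow_dvd_dim (hPo : IsOpen (P : Set G)) (hP : IsProP p P) (π : Irr G) {k : ℕ}
    (hk : P.index * p ^ k ≤ π.dim) : p ^ k ∣ π.dim := by
  obtain ⟨N, hN, hNo, hNP, hNπ⟩ := exists_forall_isTrivialOn {π} hPo P.one_mem
  have := finiteIndex_of_isOpen hNo
  have := finiteIndex_of_isOpen hPo
  obtain ⟨b, hb⟩ := exists_index_eq_index_mul_pow hP hNo hNP
  exact pow_dvd_of_dvd_mul_pow hp.out (Nat.pos_of_ne_zero Subgroup.FiniteIndex.index_ne_zero)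
    (hb ▸ (hNπ π (Finset.mem_singleton_self π)).dim_dvd_index) hk

omit [TotallyDisconnectedSpace G] in
theorem pow_dvd_index_sup (hPo : IsOpen (P : Set G)) (hP : IsProP p P) {H N N₁ : Subgroup G}
    [N.Normal] (hN : IsOpen (N : Set G)) (hNP : N ≤ P) (hNN₁ : N ≤ N₁) {k : ℕ}
    (hk : P.index * p ^ k ≤ (H ⊔ N₁).index) : p ^ k ∣ (H ⊔ N).index := by
  have hPfin := finiteIndex_of_isOpen hPo
  have hNfin := finiteIndex_of_isOpen hN
  have hHN : (H ⊔ N).FiniteIndex := Subgroup.finiteIndex_of_le le_sup_right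
  obtain ⟨b, hb⟩ := exists_index_eq_index_mul_pow hP hN hNP
  have h1 : (H ⊔ N).index ∣ P.index * p ^ b := by
    rw [← hb]
    exact Subgroup.index_dvd_of_le le_sup_right
  refine pow_dvd_of_dvd_mul_pow hp.out (Nat.pos_of_ne_zero hPfin.index_ne_zero) h1 (hk.trans ?_)
  exact Nat.le_of_dvd (Nat.pos_of_ne_zero hHN.index_ne_zero)
    (Subgroup.index_dvd_of_le (sup_le_sup_left hNN₁ H))

theorem norm_natCast_le_of_pow_dvd {k n : ℕ} (h : p ^ k ∣ n) :
    ‖(n : ℤ_[p])‖ ≤ (p : ℝ) ^ (-k : ℤ) := by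
  have h1 := (PadicInt.norm_int_le_pow_iff_dvd (p := p) (k := n) (n := k)).mpr
    (by exact_mod_cast h)
  rwa [Int.cast_natCast] at h1

theorem exists_zpow_neg_lt (p : ℕ) [hp : Fact p.Prime] {ε : ℝ} (hε : 0 < ε) :
    ∃ k : ℕ, (p : ℝ) ^ (-k : ℤ) < ε := by
  obtain ⟨k, hk⟩ := exists_pow_lt_of_lt_one hε
    (inv_lt_one_of_one_lt₀ (Nat.one_lt_cast.mpr hp.out.one_lt) : (p : ℝ)⁻¹ < 1)
  exact ⟨k, by rwa [zpow_neg, zpow_natCast, ← inv_pow]⟩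

theorem summable_mult_mul_dim (hPo : IsOpen (P : Set G)) (hP : IsProP p P) {V : Type v}
    [AddCommGroup V] [Module ℂ V] {ρ : Representation ℂ G V} (hρ : IsStronglyAdmissible ρ) :
    Summable fun π : Irr G => ((mult π ρ).toNat : ℤ_[p]) * π.dim := by
  refine NonarchimedeanAddGroup.summable_of_tendsto_cofinite_zero ?_
  rw [Metric.tendsto_nhds]
  intro ε hε
  obtain ⟨k, hk⟩ := exists_zpow_neg_lt p hε
  refine (hρ.finite_setOf_dim_le (P.index * p ^ k)).subset fun π hπ => ?_
  by_contra h
  refine hπ ?_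
  rw [Set.mem_ofPred_eq, dist_zero_right]
  rw [Set.mem_ofPred_eq, not_and_or, not_le, not_not] at h
  rcases h with h | h
  · rw [norm_mul]
    calc _ ≤ 1 * ‖(π.dim : ℤ_[p])‖ := by gcongr; exact PadicInt.norm_le_one _
      _ ≤ _ := by rw [one_mul]; exact norm_natCast_le_of_pow_dvd (π.pow_dvd_dim hPo hP h.le)
      _ < ε := hk
  · simpa [h] using hε

theorem hasSum_mult_ind_mul_dim (hPo : IsOpen (P : Set G)) (hP : IsProP p P) {H : Subgroup G}
    (hH : IsClosed (H : Set G)) (hinf : ¬ H.FiniteIndex) {W : Type v} [AddCommGroup W] [Module ℂ W]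
    [FiniteDimensional ℂ W] {θ : Representation ℂ H W} (hθ : IsSmooth θ)
    (hρ : IsStronglyAdmissible (ind H θ)) :
    HasSum (fun π : Irr G => ((mult π (ind H θ)).toNat : ℤ_[p]) * π.dim) 0 := by
  classical
  obtain ⟨S, hS⟩ := summable_mult_mul_dim hPo hP hρ
  suffices h : ‖S‖ ≤ 0 by rwa [norm_le_zero_iff.mp h] at hS
  refine le_of_forall_pos_lt_add fun ε hε => ?_
  rw [zero_add]
  obtain ⟨k, hk⟩ := exists_zpow_neg_lt p hε
  obtain ⟨s, hs⟩ := mem_atTop_sets.mp ((Metric.tendsto_nhds.mp hS) ε hε)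
  obtain ⟨N₁, -, hN₁o, hN₁⟩ := exists_normal_isOpen_le_index_sup hH hinf (P.index * p ^ k)
  obtain ⟨U, hUo, hU⟩ := isOpen_induced_iff.mp hθ.isOpen_ker
  have hU1 : (1 : G) ∈ U := by
    have h1 : (1 : H) ∈ Subtype.val ⁻¹' U := by
      rw [hU]
      exact map_one θ
    exact h1
  obtain ⟨N, hN, hNo, hNU, hNs⟩ := exists_forall_isTrivialOn s ((hPo.inter hN₁o).inter hUo)
    ⟨⟨P.one_mem, N₁.one_mem⟩, hU1⟩
  have hPfin := finiteIndex_of_isOpen hPo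
  have hNfin := finiteIndex_of_isOpen hNo
  have hHN : (H ⊔ N).FiniteIndex := Subgroup.finiteIndex_of_le le_sup_right
  have hNθ : ∀ h : H, (h : G) ∈ N → θ h = 1 := fun h hh => by
    have h1 : h ∈ Subtype.val ⁻¹' U := (hNU hh).2
    rw [hU] at h1
    exact h1
  have hdvd : p ^ k ∣ Module.finrank ℂ (fixedVectors (ind H θ) N) := by
    rw [finrank_fixedVectors_ind hNo hNθ]
    exact (pow_dvd_index_sup hPo hP hNo (fun x hx => (hNU hx).1.1) (fun x hx => (hNU hx).1.2)
      hN₁).mul_right _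
  have := hρ.1.2 N hNo
  obtain ⟨M, hMN, hM, hMd⟩ := exists_multiset_irr_fixedVectors hNo (ind H θ)
  have hsum : ∑ π ∈ M.toFinset ∪ s, ((mult π (ind H θ)).toNat : ℤ_[p]) * π.dim =
      (Module.finrank ℂ (fixedVectors (ind H θ) N) : ℤ_[p]) := by
    rw [hMd, Finset.sum_multiset_map_count, ← Finset.sum_subset Finset.subset_union_left
      fun π hπ hπM => ?_, Nat.cast_sum]
    · refine Finset.sum_congr rfl fun π hπ => ?_
      rw [hM π (hMN π (Multiset.mem_toFinset.mp hπ)), ENat.toNat_natCast]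
      simp
    · have hπs : π ∈ s := (Finset.mem_union.mp hπ).resolve_left hπM
      rw [hM π (hNs π hπs), Multiset.count_eq_zero.mpr fun h => hπM (Multiset.mem_toFinset.mpr h)]
      simp
  have h1 := hs _ (Finset.subset_union_right : s ⊆ M.toFinset ∪ s)
  change dist (∑ π ∈ M.toFinset ∪ s, _) S < ε at h1
  rw [hsum, dist_eq_norm, norm_sub_rev] at h1
  have h2 := (norm_natCast_le_of_pow_dvd (p := p) hdvd).trans_lt hk
  calc ‖S‖ = ‖(S - _) + (Module.finrank ℂ (fixedVectors (ind H θ) N) : ℤ_[p])‖ := by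
        rw [sub_add_cancel]
    _ ≤ _ := PadicInt.nonarchimedean _ _
    _ < ε := max_lt h1 h2

end Profinite

end SmoothRep

namespace SmoothRep

open Filter Topology Polynomial

section Shift

/-- The operator `(shift p c) n = c (n / p)` on arithmetic functions; it corresponds to
multiplication of Dirichlet series by `p ^ (-s)`. -/
def shift (p : ℕ) : Module.End ℚ (ℕ → ℚ) where
  toFun c n := if p ∣ n then c (n / p) else 0
  map_add' c d := by
    ext n
    by_cases h : p ∣ n <;> simp [h]
  map_smul' a c := by
    ext n
    by_cases h : p ∣ n <;> simp [h]

theorem shift_mul {p : ℕ} (hp : 0 < p) (c : ℕ → ℚ) (n : ℕ) : shift p c (p * n) = c n := by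
  simp [shift, hp]

theorem shift_of_not_dvd {p n : ℕ} (h : ¬ p ∣ n) (c : ℕ → ℚ) : shift p c n = 0 := by
  simp [shift, h]

/-- If `R c a` is compatible with linear combinations, and `R (shift p c) (x * a)` follows from
`R c a`, then `R c a` implies `R (B c) (B(x) a)` for polynomials `B` in the shift operator. -/
theorem aeval_shift_induction {p : ℕ} {K : Type*} [CommRing K] [Algebra ℚ K]
    {R : (ℕ → ℚ) → K → Prop} {x : K} (hadd : ∀ c d a b, R c a → R d b → R (c + d) (a + b))
    (hsmul : ∀ (q : ℚ) c a, R c a → R (q • c) (algebraMap ℚ K q * a))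
    (hshift : ∀ c a, R c a → R (shift p c) (x * a)) {c : ℕ → ℚ} {a : K} (hc : R c a) (B : ℚ[X]) :
    R (aeval (shift p) B c) (aeval x B * a) := by
  induction B using Polynomial.induction_on with
  | C q => simpa [Algebra.algebraMap_eq_smul_one] using hsmul q c a hc
  | add B C hB hC => simpa [add_mul] using hadd _ _ _ _ hB hC
  | monomial n q h =>
    have h1 := hshift _ _ h
    have h2 : aeval (shift p) (C q * X ^ (n + 1)) c = shift p (aeval (shift p) (C q * X ^ n) c) := by
      rw [pow_succ, ← mul_assoc, mul_comm, map_mul, Module.End.mul_apply, aeval_X]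
    rw [h2]
    convert h1 using 1
    simp only [map_mul, aeval_C, aeval_X_pow]
    ring

theorem lSeriesHasSum_shift {p : ℕ} (hp : 0 < p) {c : ℕ → ℚ} {s a : ℂ}
    (h : LSeriesHasSum (fun n => (c n : ℂ)) s a) :
    LSeriesHasSum (fun n => (shift p c n : ℂ)) s ((p : ℂ) ^ (-s) * a) := by
  have hinj : Function.Injective fun n : ℕ => p * n := fun m n h => Nat.eq_of_mul_eq_mul_left hp h
  refine (hinj.hasSum_iff fun n hn => ?_).mp ?_
  · have : ¬ p ∣ n := fun ⟨m, hm⟩ => hn ⟨m, hm.symm⟩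
    simp [LSeries.term, shift_of_not_dvd this]
  · have h1 := HasSum.mul_left ((p : ℂ) ^ (-s)) h
    refine h1.congr_fun fun n => ?_
    rcases eq_or_ne n 0 with rfl | hn
    · simp
    · rw [Function.comp_apply, LSeries.term_of_ne_zero hn,
        LSeries.term_of_ne_zero (Nat.mul_ne_zero hp.ne' hn), shift_mul hp, Nat.cast_mul,
        Complex.natCast_mul_natCast_cpow, Complex.cpow_neg, div_mul_eq_div_div,
        inv_mul_eq_div, div_right_comm]

theorem lSeriesHasSum_aeval_shift {p : ℕ} (hp : 0 < p) {c : ℕ → ℚ} {s a : ℂ}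
    (h : LSeriesHasSum (fun n => (c n : ℂ)) s a) (B : ℚ[X]) :
    LSeriesHasSum (fun n => (aeval (shift p) B c n : ℂ)) s (aeval ((p : ℂ) ^ (-s)) B * a) := by
  refine aeval_shift_induction (R := fun c a => LSeriesHasSum (fun n => (c n : ℂ)) s a)
    (fun c d a b h1 h2 => ?_) (fun q c a h => ?_) (fun c a h => lSeriesHasSum_shift hp h) h B
  · convert h1.add h2 using 1
    ext n
    simp
  · convert h.smul (q : ℂ) using 1
    · ext n
      simp
    · simp

theorem hasSum_padic_aeval_shift {p : ℕ} [hp : Fact p.Prime] {c : ℕ → ℚ} {a : ℚ_[p]}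
    (h : HasSum (fun n => (c n : ℚ_[p]) * n) a) (B : ℚ[X]) :
    HasSum (fun n => (aeval (shift p) B c n : ℚ_[p]) * n) (aeval (p : ℚ_[p]) B * a) := by
  refine aeval_shift_induction (R := fun c a => HasSum (fun n => (c n : ℚ_[p]) * n) a)
    (fun c d a b h1 h2 => ?_) (fun q c a h => ?_) (fun c a h => ?_) h B
  · refine (h1.add h2).congr_fun fun n => ?_
    simp [add_mul]
  · rw [eq_ratCast]
    refine (h.mul_left (q : ℚ_[p])).congr_fun fun n => ?_
    simp [mul_assoc]
  · have hinj : Function.Injective fun n : ℕ => p * n :=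
      fun m n h => Nat.eq_of_mul_eq_mul_left hp.out.pos h
    refine (hinj.hasSum_iff fun n hn => ?_).mp ?_
    · have : ¬ p ∣ n := fun ⟨m, hm⟩ => hn ⟨m, hm.symm⟩
      simp [shift_of_not_dvd this]
    · refine (h.mul_left (p : ℚ_[p])).congr_fun fun n => ?_
      rw [Function.comp_apply, shift_mul hp.out.pos]
      push_cast
      ring

theorem finite_support_aeval_shift (p : ℕ) {c : ℕ → ℚ} (h : c.support.Finite) (B : ℚ[X]) :
    (aeval (shift p) B c).support.Finite := by
  refine aeval_shift_induction (K := ℚ) (x := 0) (R := fun c _ => c.support.Finite)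
    (fun c d _ _ h1 h2 => ?_) (fun q c _ h => ?_) (fun c _ h => ?_) (a := 0) h B
  · exact (h1.union h2).subset (Function.support_add c d)
  · exact h.subset (Function.support_const_smul_subset q c)
  · refine (h.image fun n => p * n).subset fun n hn => ?_
    rw [Function.mem_support] at hn
    by_cases hd : p ∣ n
    · exact ⟨n / p, by simpa [shift, hd] using hn, Nat.mul_div_cancel' hd⟩
    · exact absurd (shift_of_not_dvd hd c) hn

/-- Polynomials in the shift operator preserve boundedness of denominators. -/
theorem exists_bounded_denom_aeval_shift (p : ℕ) (r : ℕ → ℤ) (B : ℚ[X]) :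
    ∃ D : ℕ, D ≠ 0 ∧ ∀ n, ∃ z : ℤ, D * aeval (shift p) B (fun n => (r n : ℚ)) n = z := by
  refine aeval_shift_induction (K := ℚ) (x := 0)
    (R := fun c _ => ∃ D : ℕ, D ≠ 0 ∧ ∀ n, ∃ z : ℤ, D * c n = z)
    (fun c d _ _ ⟨D, hD, h1⟩ ⟨E, hE, h2⟩ => ⟨D * E, mul_ne_zero hD hE, fun n => ?_⟩)
    (fun q c _ ⟨D, hD, h⟩ => ⟨q.den * D, mul_ne_zero q.den_nz hD, fun n => ?_⟩)
    (fun c _ ⟨D, hD, h⟩ => ⟨D, hD, fun n => ?_⟩) (a := 0) ⟨1, one_ne_zero, fun n => ⟨r n, by simp⟩⟩ B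
  · obtain ⟨z, hz⟩ := h1 n
    obtain ⟨w, hw⟩ := h2 n
    refine ⟨E * z + D * w, ?_⟩
    rw [Pi.add_apply]
    push_cast
    rw [← hz, ← hw]
    ring
  · obtain ⟨z, hz⟩ := h n
    refine ⟨q.num * z, ?_⟩
    rw [Pi.smul_apply, smul_eq_mul]
    push_cast
    rw [← hz, ← Rat.mul_den_eq_num q]
    ring
  · by_cases hd : p ∣ n
    · obtain ⟨z, hz⟩ := h (n / p)
      exact ⟨z, by simpa [shift, hd] using hz⟩
    · exact ⟨0, by simp [shift_of_not_dvd hd]⟩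

/-- If `(X - p) β` has finite support and `β` has bounded denominators, then `β` has finite
support. -/
theorem finite_support_of_shift_sub {p : ℕ} (hp : 1 < p) {β : ℕ → ℚ} {D : ℕ} (hD : D ≠ 0)
    (hβ : ∀ n, ∃ z : ℤ, D * β n = z)
    (h : (aeval (shift p) (X - C (p : ℚ)) β).support.Finite) : β.support.Finite := by
  set α := aeval (shift p) (X - C (p : ℚ)) β with hα
  have hα' (n : ℕ) : α n = shift p β n - p * β n := by
    simp [hα, Algebra.algebraMap_eq_smul_one, -map_natCast]
  have hfin : (insert 0 (⋃ m ∈ α.support, (m.divisors : Set ℕ))).Finite :=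
    (h.biUnion fun m _ => m.divisors.finite_toSet).insert 0
  refine hfin.subset fun n hn => ?_
  rw [Set.mem_insert_iff, or_iff_not_imp_left]
  intro hn0
  by_contra hcon
  have hz (j : ℕ) : α (p ^ (j + 1) * n) = 0 := by
    by_contra hj
    refine hcon (Set.mem_biUnion hj ?_)
    simp only [Finset.mem_coe, Nat.mem_divisors]
    exact ⟨dvd_mul_left _ _, mul_ne_zero (pow_ne_zero _ (by omega)) hn0⟩
  have hstep (j : ℕ) : (p : ℚ) ^ j * β (p ^ j * n) = β n := by
    induction j with
    | zero => simp
    | succ j ih =>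
      have h1 := hz j
      rw [hα', sub_eq_zero, pow_succ', mul_assoc, shift_mul (by omega)] at h1
      rw [← ih, h1, pow_succ' p, mul_assoc p, pow_succ]
      ring
  obtain ⟨z, hz0⟩ := hβ n
  have hdvd (j : ℕ) : ((p : ℤ) ^ j) ∣ z := by
    obtain ⟨w, hw⟩ := hβ (p ^ j * n)
    refine ⟨w, ?_⟩
    have : (z : ℚ) = (p : ℚ) ^ j * w := by
      rw [← hz0, ← hw, ← hstep j]
      ring
    exact_mod_cast this
  have hz1 : z = 0 := Int.eq_zero_of_dvd_of_natAbs_lt_natAbs (hdvd z.natAbs) (by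
    rw [Int.natAbs_pow, Int.natAbs_natCast]
    exact Nat.lt_pow_self hp)
  rw [hz1, Int.cast_zero, mul_eq_zero] at hz0
  exact hn (hz0.resolve_left (Nat.cast_ne_zero.mpr hD))

/-- A polynomial in the shift operator taking an integral sequence to one of finite support can be
chosen not to vanish at `p`. -/
theorem exists_aeval_ne_zero_finite_support {p : ℕ} (hp : 1 < p) (r : ℕ → ℤ) {B : ℚ[X]} (hB : B ≠ 0)
    (h : (aeval (shift p) B fun n => (r n : ℚ)).support.Finite) :
    ∃ B : ℚ[X], B.eval (p : ℚ) ≠ 0 ∧ (aeval (shift p) B fun n => (r n : ℚ)).support.Finite := by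
  induction hd : B.natDegree generalizing B with
  | zero =>
    refine ⟨B, fun h0 => hB ?_, h⟩
    rw [eq_C_of_natDegree_eq_zero hd, eval_C] at h0
    rw [eq_C_of_natDegree_eq_zero hd, h0, C_0]
  | succ d ih =>
    by_cases h0 : B.eval (p : ℚ) = 0
    · obtain ⟨B', rfl⟩ := dvd_iff_isRoot.mpr h0
      have hB' := right_ne_zero_of_mul hB
      obtain ⟨D, hD, hden⟩ := exists_bounded_denom_aeval_shift p r B'
      rw [map_mul, Module.End.mul_apply] at h
      refine ih hB' (finite_support_of_shift_sub hp hD hden h) ?_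
      rw [natDegree_mul (X_sub_C_ne_zero _) hB', natDegree_X_sub_C] at hd
      omega
    · exact ⟨B, h0, h⟩

end Shift

end SmoothRep

namespace SmoothRep

open Filter Topology Polynomial

section Rational

theorem analyticAt_natCast_cpow_neg {p : ℕ} (hp : 0 < p) (s : ℂ) :
    AnalyticAt ℂ (fun s : ℂ => (p : ℂ) ^ (-s)) s := by
  have hp' : (p : ℂ) ≠ 0 := Nat.cast_ne_zero.mpr hp.ne'
  have h : Differentiable ℂ fun s : ℂ => (p : ℂ) ^ (-s) := fun s =>
    (differentiableAt_id.neg).const_cpow (Or.inl hp')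
  exact h.analyticAt s

/-- A nonzero polynomial in `p ^ (-x)` does not vanish for large real `x`. -/
theorem eventually_aeval_cpow_ne_zero {p : ℕ} (hp : 1 < p) {B : ℚ[X]} (hB : B ≠ 0) :
    ∀ᶠ x : ℝ in atTop, aeval ((p : ℂ) ^ (-(x : ℂ))) B ≠ 0 := by
  have hfin : {z : ℂ | aeval z B = 0}.Finite := by
    refine (B.rootSet_finite ℂ).subset fun z hz => ?_
    exact (mem_rootSet_of_ne hB).mpr hz
  have hinj : Function.Injective fun x : ℝ => (p : ℂ) ^ (-(x : ℂ)) := by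
    intro x y hxy
    have h1 (x : ℝ) : (p : ℂ) ^ (-(x : ℂ)) = (((p : ℝ) ^ (-x) : ℝ) : ℂ) := by
      rw [Complex.ofReal_cpow (Nat.cast_nonneg p)]
      simp
    simp only [h1, Complex.ofReal_inj] at hxy
    have hp0 : (0 : ℝ) < p := by exact_mod_cast (by omega : 0 < p)
    have := (Real.rpow_right_inj hp0 (by exact_mod_cast hp.ne')).mp hxy
    linarith
  have h2 := (hfin.preimage hinj.injOn).bddAbove
  obtain ⟨y, hy⟩ := h2
  filter_upwards [eventually_gt_atTop y] with x hx h0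
  exact absurd (hy h0) (not_le.mpr hx)

/-- A meromorphic continuation which is of the form `∑ mᵢ^{-s} Fᵢ(p^{-s})` agrees with this
expression for large real `s`. -/
theorem eventually_lSeries_eq_of_rational {p : ℕ} (hp : 1 < p) {a : ℕ → ℂ}
    {f : ℂ → ℂ} (hf : IsMeromorphicContinuation a f)
    {k : ℕ} {m : Fin k → ℕ} {F : Fin k → RatFunc ℚ} (hm : ∀ i, 0 < m i)
    (h : f =ᶠ[codiscrete ℂ] fun s =>
      ∑ i, (m i : ℂ) ^ (-s) * (F i).eval (algebraMap ℚ ℂ) ((p : ℂ) ^ (-s)))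
    {x : ℝ} (hx : LSeries.abscissaOfAbsConv a < x)
    (hF : ∀ i, aeval ((p : ℂ) ^ (-(x : ℂ))) (F i).denom ≠ 0) :
    LSeries a x = ∑ i, (m i : ℂ) ^ (-(x : ℂ)) *
      (F i).eval (algebraMap ℚ ℂ) ((p : ℂ) ^ (-(x : ℂ))) := by
  have hxre : LSeries.abscissaOfAbsConv a < ((x : ℂ).re : EReal) := by simpa using hx
  have h1 : f =ᶠ[𝓝 (x : ℂ)] LSeries a := by
    filter_upwards [(Complex.isOpen_re_gt_EReal _).mem_nhds hxre] with s hs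
    exact hf.eq_series s hs
  have hfc : ContinuousAt f x :=
    ((LSeries_analyticOnNhd a x hxre).continuousAt).congr h1.symm
  have hgc : ContinuousAt (fun s : ℂ => ∑ i, (m i : ℂ) ^ (-s) *
      (F i).eval (algebraMap ℚ ℂ) ((p : ℂ) ^ (-s))) x := by
    refine tendsto_finsetSum _ fun i _ => ?_
    refine (analyticAt_natCast_cpow_neg (hm i) x).continuousAt.mul ?_
    have hc (B : ℚ[X]) : ContinuousAt (fun s : ℂ => B.eval₂ (algebraMap ℚ ℂ) ((p : ℂ) ^ (-s))) x := by
      have h2 : Continuous fun z : ℂ => B.eval₂ (algebraMap ℚ ℂ) z :=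
        Polynomial.continuous_eval₂ _ _
      exact h2.continuousAt.comp (analyticAt_natCast_cpow_neg (by omega) (x : ℂ)).continuousAt
    exact (hc _).div (hc _) (hF i)
  have h2 : f =ᶠ[𝓝[≠] (x : ℂ)] fun s => ∑ i, (m i : ℂ) ^ (-s) *
      (F i).eval (algebraMap ℚ ℂ) ((p : ℂ) ^ (-s)) := by
    have := mem_codiscrete.mp h x
    rwa [disjoint_principal_right, compl_compl] at this
  have h3 := ((hfc.eventuallyEq_nhds_iff_eventuallyEq_nhdsNE hgc).mp h2).eq_of_nhds
  rw [← h1.eq_of_nhds]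
  exact h3

theorem lSeriesSummable_of_finite_support {c : ℕ → ℂ} (h : c.support.Finite) (s : ℂ) :
    LSeriesSummable c s := by
  refine summable_of_hasFiniteSupport (h.subset fun n hn => ?_)
  rw [Function.mem_support] at hn ⊢
  intro h0
  exact hn (by simp [LSeries.term, h0])

theorem lSeriesHasSum_single {m : ℕ} (hm : 0 < m) (s : ℂ) :
    LSeriesHasSum (fun n => ((Pi.single m 1 : ℕ → ℚ) n : ℂ)) s ((m : ℂ) ^ (-s)) := by
  have h1 := hasSum_single (f := LSeries.term (fun n => ((Pi.single m 1 : ℕ → ℚ) n : ℂ)) s) m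
    fun n hn => by simp [LSeries.term, hn]
  rwa [LSeries.term_of_ne_zero hm.ne', Pi.single_eq_same, Rat.cast_one, one_div,
    ← Complex.cpow_neg] at h1

theorem abscissaOfAbsConv_lt_top_of_forall {c : ℕ → ℂ} {y : ℝ}
    (h : ∀ x : ℝ, y < x → LSeriesSummable c x) : LSeries.abscissaOfAbsConv c < ⊤ :=
  (LSeries.abscissaOfAbsConv_le_of_forall_lt_LSeriesSummable h).trans_lt (EReal.coe_lt_top y)

/-- If the Dirichlet series with coefficients `c` is rational with respect to `p`, then some
nonzero polynomial in the shift operator takes `c` to a sequence of finite support. -/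
theorem IsRationalWithRespectTo.exists_finite_support {p : ℕ} (hp : 1 < p) {c : ℕ → ℚ}
    (h : IsRationalWithRespectTo p fun n => (c n : ℂ)) :
    ∃ B : ℚ[X], B ≠ 0 ∧ (aeval (shift p) B c).support.Finite := by
  obtain ⟨ha, f, hf, k, m, F, hm, hfF⟩ := h
  set B : ℚ[X] := ∏ i, (F i).denom with hBdef
  have hB : B ≠ 0 := Finset.prod_ne_zero_iff.mpr fun i _ => (F i).denom_ne_zero
  refine ⟨B, hB, ?_⟩
  let A (i : Fin k) : ℚ[X] := (F i).num * ∏ j ∈ Finset.univ.erase i, (F j).denom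
  let d : ℕ → ℚ := ∑ i, aeval (shift p) (A i) (Pi.single (m i) 1)
  have hdfin : d.support.Finite := by
    refine (Set.finite_iUnion fun i => finite_support_aeval_shift p
      (c := Pi.single (m i) 1) ((Set.finite_singleton (m i)).subset ?_) (A i)).subset
      fun n hn => ?_
    · exact Pi.support_single_subset
    · rw [Function.mem_support, show d n = ∑ i, aeval (shift p) (A i) (Pi.single (m i) 1) n from
        Finset.sum_apply _ _ _] at hn
      obtain ⟨i, -, hi⟩ := Finset.exists_ne_zero_of_sum_ne_zero hn
      exact Set.mem_iUnion.mpr ⟨i, hi⟩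
  have hdsum (s : ℂ) : LSeriesHasSum (fun n => (d n : ℂ)) s
      (∑ i, aeval ((p : ℂ) ^ (-s)) (A i) * (m i : ℂ) ^ (-s)) := by
    have h1 := LSeriesHasSum.sum (S := Finset.univ) (s := s) fun i _ =>
      lSeriesHasSum_aeval_shift (p := p) (by omega) (lSeriesHasSum_single (hm i) s) (A i)
    convert h1 using 1
    ext n
    simp [d, Finset.sum_apply]
  have hBsum (x : ℝ) (hx : LSeries.abscissaOfAbsConv (fun n => (c n : ℂ)) < x) :
      LSeriesHasSum (fun n => (aeval (shift p) B c n : ℂ)) x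
        (aeval ((p : ℂ) ^ (-(x : ℂ))) B * LSeries (fun n => (c n : ℂ)) x) :=
    lSeriesHasSum_aeval_shift (by omega)
      (LSeriesSummable_of_abscissaOfAbsConv_lt_re (by simpa using hx)).LSeriesHasSum B
  obtain ⟨y, hy, -⟩ := EReal.exists_between_coe_real ha
  have heq : (fun x : ℝ => LSeries (fun n => (aeval (shift p) B c n : ℂ)) x) =ᶠ[atTop]
      fun x : ℝ => LSeries (fun n => (d n : ℂ)) x := by
    filter_upwards [eventually_gt_atTop y, eventually_aeval_cpow_ne_zero hp hB] with x hx hx0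
    have hx' : LSeries.abscissaOfAbsConv (fun n => (c n : ℂ)) < x :=
      hy.trans (EReal.coe_lt_coe_iff.mpr hx)
    have hF (i : Fin k) : aeval ((p : ℂ) ^ (-(x : ℂ))) (F i).denom ≠ 0 := by
      rw [hBdef, map_prod] at hx0
      exact Finset.prod_ne_zero_iff.mp hx0 i (Finset.mem_univ i)
    rw [(hBsum x hx').LSeries_eq, (hdsum x).LSeries_eq,
      eventually_lSeries_eq_of_rational hp hf hm hfF hx' hF, Finset.mul_sum]
    refine Finset.sum_congr rfl fun i _ => ?_
    have h1 : (F i).eval (algebraMap ℚ ℂ) ((p : ℂ) ^ (-(x : ℂ))) =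
      aeval ((p : ℂ) ^ (-(x : ℂ))) (F i).num / aeval ((p : ℂ) ^ (-(x : ℂ))) (F i).denom := rfl
    rw [h1, hBdef, ← Finset.mul_prod_erase _ _ (Finset.mem_univ i), map_mul, map_mul]
    field_simp [hF i]
  have hcd {n : ℕ} (hn : n ≠ 0) : aeval (shift p) B c n = d n := by
    have h1 := LSeries.eq_of_LSeries_eventually_eq
      (abscissaOfAbsConv_lt_top_of_forall fun x hx =>
        (hBsum x (hy.trans (EReal.coe_lt_coe_iff.mpr hx))).LSeriesSummable)
      (abscissaOfAbsConv_lt_top_of_forall (y := y) fun x _ => (hdsum x).LSeriesSummable) heq hn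
    exact_mod_cast h1
  refine (hdfin.insert 0).subset fun n hn => ?_
  rw [Set.mem_insert_iff, or_iff_not_imp_left]
  intro hn0
  rwa [Function.mem_support, ← hcd hn0]

/-- Let `∑ rₙ n^{-s}` be a Dirichlet series with integral coefficients which is rational with
respect to `p`. If `∑ rₙ n` converges to `0` in `ℚ_p`, then the meromorphic continuation is regular
and vanishes at `-1`. -/
theorem IsRationalWithRespectTo.analyticAt_and_eq_zero {p : ℕ} [hp : Fact p.Prime] {r : ℕ → ℤ}
    (h : IsRationalWithRespectTo p fun n => (((r n : ℤ) : ℚ) : ℂ))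
    (hsum : HasSum (fun n => (((r n : ℤ) : ℚ) : ℚ_[p]) * n) 0) {f : ℂ → ℂ}
    (hf : IsMeromorphicContinuation (fun n => (((r n : ℤ) : ℚ) : ℂ)) f) :
    AnalyticAt ℂ f (-1) ∧ f (-1) = 0 := by
  have hp1 := hp.out.one_lt
  obtain ⟨B₀, hB₀, hB₀fin⟩ := h.exists_finite_support hp1
  obtain ⟨B, hB, hBfin⟩ := exists_aeval_ne_zero_finite_support hp1 r hB₀ hB₀fin
  set c : ℕ → ℚ := fun n => (r n : ℚ) with hc
  set d : ℕ → ℚ := aeval (shift p) B c with hd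
  have hdfin : (fun n => (d n : ℂ)).support.Finite := hBfin.subset fun n hn h0 => hn (by simp [h0])
  have hzero : ∑ n ∈ hBfin.toFinset, d n * n = 0 := by
    have h1 := hasSum_padic_aeval_shift hsum B
    rw [mul_zero] at h1
    have h2 : HasSum (fun n => (d n : ℚ_[p]) * n)
        (∑ n ∈ hBfin.toFinset, (d n : ℚ_[p]) * n) :=
      hasSum_sum_of_ne_finset_zero fun n hn => by
        have : d n = 0 := by simpa using hn
        simp [this]
    have h3 := h2.unique h1
    exact_mod_cast h3
  have hLzero : LSeries (fun n => (d n : ℂ)) (-1) = 0 := by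
    have h1 : LSeries (fun n => (d n : ℂ)) (-1) = ∑ n ∈ hBfin.toFinset, (d n : ℂ) * n := by
      rw [LSeries, tsum_eq_sum (s := hBfin.toFinset) fun n hn => ?_]
      · refine Finset.sum_congr rfl fun n _ => ?_
        rcases eq_or_ne n 0 with rfl | hn
        · simp
        · rw [LSeries.term_of_ne_zero hn, Complex.cpow_neg_one, div_inv_eq_mul]
      · have : d n = 0 := by simpa using hn
        simp [LSeries.term, this]
    rw [h1]
    exact_mod_cast congrArg (fun q : ℚ => (q : ℂ)) hzero
  have hLan (s : ℂ) : AnalyticAt ℂ (LSeries fun n => (d n : ℂ)) s := by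
    refine LSeries_analyticOnNhd _ s ?_
    have h1 := (lSeriesSummable_of_finite_support hdfin (s - 1)).abscissaOfAbsConv_le
    refine h1.trans_lt (EReal.coe_lt_coe_iff.mpr ?_)
    simp
  have hban (s : ℂ) : AnalyticAt ℂ (fun s : ℂ => aeval ((p : ℂ) ^ (-s)) B) s :=
    (analyticAt_natCast_cpow_neg hp.out.pos s).aeval_polynomial B
  have hb1 : aeval ((p : ℂ) ^ (-(-1 : ℂ))) B ≠ 0 := by
    rw [neg_neg, Complex.cpow_one, show (p : ℂ) = algebraMap ℚ ℂ p by simp,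
      aeval_algebraMap_apply_eq_algebraMap_eval]
    simpa using hB
  have hmer : Meromorphic fun s => f s * aeval ((p : ℂ) ^ (-s)) B - LSeries (fun n => (d n : ℂ)) s :=
    fun s => ((hf.meromorphic (Set.mem_univ s)).meromorphicAt.mul (hban s).meromorphicAt).sub
      (hLan s).meromorphicAt
  obtain ⟨y, hy, -⟩ := EReal.exists_between_coe_real h.1
  have htop : meromorphicOrderAt
      (fun s => f s * aeval ((p : ℂ) ^ (-s)) B - LSeries (fun n => (d n : ℂ)) s) y = ⊤ := by
    rw [meromorphicOrderAt_eq_top_iff]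
    refine eventually_nhdsWithin_of_eventually_nhds ?_
    have hy' : LSeries.abscissaOfAbsConv (fun n => (((r n : ℤ) : ℚ) : ℂ)) < ((y : ℂ).re : EReal) := by
      simpa using hy
    filter_upwards [(Complex.isOpen_re_gt_EReal _).mem_nhds hy'] with s hs
    rw [hf.eq_series s hs, (lSeriesHasSum_aeval_shift hp.out.pos
      (LSeriesSummable_of_abscissaOfAbsConv_lt_re hs).LSeriesHasSum B).LSeries_eq, mul_comm,
      sub_self]
  have htop1 : meromorphicOrderAt
      (fun s => f s * aeval ((p : ℂ) ^ (-s)) B - LSeries (fun n => (d n : ℂ)) s) (-1) = ⊤ := by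
    by_contra hne
    exact hmer.exists_meromorphicOrderAt_ne_top_iff_forall.mp ⟨_, hne⟩ y htop
  rw [meromorphicOrderAt_eq_top_iff] at htop1
  have hgan : AnalyticAt ℂ
      (fun s => LSeries (fun n => (d n : ℂ)) s / aeval ((p : ℂ) ^ (-s)) B) (-1) :=
    (hLan _).div (hban _) hb1
  have hfg : f =ᶠ[𝓝[≠] (-1)] fun s => LSeries (fun n => (d n : ℂ)) s / aeval ((p : ℂ) ^ (-s)) B := by
    filter_upwards [htop1, eventually_nhdsWithin_of_eventually_nhds
      ((hban (-1)).continuousAt.eventually_ne hb1)] with s hs hs0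
    rw [eq_div_iff hs0]
    exact sub_eq_zero.mp hs
  have hfan : AnalyticAt ℂ f (-1) := by
    rw [← (hf.meromorphic (Set.mem_univ _)).meromorphicOrderAt_nonneg_iff_analyticAt,
      meromorphicOrderAt_congr hfg]
    exact hgan.meromorphicOrderAt_nonneg
  refine ⟨hfan, ?_⟩
  rw [((hfan.continuousAt.eventuallyEq_nhds_iff_eventuallyEq_nhdsNE hgan.continuousAt).mp
    hfg).eq_of_nhds, hLzero, zero_div]

end Rational

end SmoothRep

theorem mainTheorem12 (p : ℕ) [Fact p.Prime]
    (G : Type*) [Group G] [TopologicalSpace G] [IsTopologicalGroup G] [CompactSpace G]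
    [TotallyDisconnectedSpace G] (hG : SmoothRep.IsVirtuallyProP p G)
    (H : Subgroup G) (hHclosed : IsClosed (H : Set G)) (hHindex : ¬ H.FiniteIndex)
    (W : Type*) [AddCommGroup W] [Module ℂ W] [FiniteDimensional ℂ W]
    (θ : Representation ℂ H W) (hθ : SmoothRep.IsSmooth θ)
    (hρ : SmoothRep.IsPolynomiallyStronglyAdmissible (SmoothRep.ind H θ)) :
    HasSum (fun n : ℕ => ((SmoothRep.irrCount (SmoothRep.ind H θ) n).toNat : ℤ_[p]) * n) 0 ∧
    (SmoothRep.IsRationalWithRespectTo p (SmoothRep.zetaCoeff (SmoothRep.ind H θ)) →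
      ∀ f : ℂ → ℂ,
        SmoothRep.IsMeromorphicContinuation (SmoothRep.zetaCoeff (SmoothRep.ind H θ)) f →
          AnalyticAt ℂ f (-1) ∧ f (-1) = 0) := by
  obtain ⟨P, hPo, hP⟩ := hG
  have hsum := hρ.1.hasSum_irrCount (SmoothRep.hasSum_mult_ind_mul_dim hPo hP hHclosed hHindex hθ hρ.1)
  refine ⟨hsum, fun hrat f hf => ?_⟩
  have hcoeff : SmoothRep.zetaCoeff (SmoothRep.ind H θ) = fun n =>
      ((((SmoothRep.irrCount (SmoothRep.ind H θ) n).toNat : ℤ) : ℚ) : ℂ) := by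
    ext n
    simp [SmoothRep.zetaCoeff]
  rw [hcoeff] at hrat hf
  refine hrat.analyticAt_and_eq_zero ?_ hf
  have h1 := hsum.map (PadicInt.Coe.ringHom (p := p)) continuous_subtype_val
  rw [map_zero] at h1
  refine h1.congr_fun fun n => ?_
  simp
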